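/- **Setting.** Let $d,k\in\mathbb N$, $\mu\in\mathbb R^d$, $G\sim N(\mu,\mathbb I_d)$, $\tau\in(0,1)$, and $\gamma(\alpha)=\log\big(\frac{dk}{\alpha}\log\frac1\tau\big)$. For a finite multiset $T\subset\mathbb R^d$ and a function $p$, $p(T)$ denotes $p(x)$ with $x$ uniform in $T$, and $\Pr_T$ is the corresponding probability; sub-multisets, cardinalities and intersections are counted with multiplicity (in $S\cap T$, by the minimum of the multiplicities). A *$k^2$-sparse polynomial* of degree $l$ is either a linear form $p(x)=v\cdot x$ with at most $k^2$ non-zero coefficients ($l=1$), or $p(x)=h_A(x)=\frac1{\sqrt2}\big(\sum_i A_{ii}(x_i^2-1)+\sum_{i\ne j}A_{ij}x_ix_j\big)$ with $A$ symmetric with at most $k^2$ non-zero entries ($l=2$). A finite multiset $S$ is *representative* (at level $\alpha$) if $|\Pr[p(G)\ge\theta]-\Pr[p(S)\ge\theta]|\le\frac{\alpha^3}{100\,k^4\gamma(\alpha)^2}$ for every $k^2$-sparse $p$ and every $\theta\in\mathbb R$. Fix a diameter bound $\rho$. For $0<\alpha\le1$, $T$ is *$\alpha$-good* if there is a representative $S$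 (at level $\alpha$) with $|S\cap T|\ge\max\{(1-\alpha/6)|S|,\alpha|T|\}$, and $\|x-y\|_\infty\le\rho$ for all $x,y\in T$. A list of pairs $(T_i,\alpha_i)$ with $T_i\subseteq T$, $\alpha_i>0$ satisfies the *multifilter condition* for $(T,\alpha)$ if $\sum_i\alpha_i^{-2}\le\alpha^{-2}$ and, whenever $T$ is $\alpha$-good, some $T_i$ is $\alpha_i$-good. **Algorithm BasicMultifilter** with constants $C,C'$, on input $(p,T,\alpha,\tau)$, $p$ of degree $l$. Put $R=(C\log\frac1\alpha)^{l/2}$, $L=C R\log(2+\log\frac1\alpha)$, $\gamma=\gamma(\alpha)$. 1. If $\max_{x,y\in T}|p(x)-p(y)|\ge(C(1+k^2\gamma/l))^{l/2}$, return "NO". 2. Otherwise, if some interval $[a,b]$ of length $L$ contains at least a $(1-\alpha/2)$-fraction of the values $p(x)$, $x\in T$, choose one. If $\mathrm{Var}[p(T)]\le C'\log^l(\frac1\alpha)\log^2(2+\log\frac1\alpha)$, return "YES". Otherwise find $t>2R$ with $$\Pr_{x\in T}\big[\mathrm{dist}(p(x),[a,b])\ge t\big]>\tfrac{32}{\alpha}\exp\big(-(t-2R)^{2/l}/C\big)+\tfrac{2\alpha^2}{(k^2\gamma)^2},$$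 and return $\{(T',\alpha')\}$, where $T'=\{x\in T:\mathrm{dist}(p(x),[a,b])<t\}$ and $\alpha'=\alpha\big(\frac{(1-\alpha/8)|T|}{|T'|}+\frac\alpha8\big)$. 3. If there is no such interval, find $t\in\mathbb R$ such that $T_1=\{x\in T:p(x)>t-R\}$ and $T_2=\{x\in T:p(x)<t+R\}$ satisfy $|T_1|^2+|T_2|^2\le|T|^2(1-\alpha/100)^2$ and $|T|-\max(|T_1|,|T_2|)\ge\alpha|T|/4$, and return $\{(T_1,\alpha_1),(T_2,\alpha_2)\}$ with $\alpha_i=\alpha(1-\alpha^2/100)|T|/|T_i|$. **Proposition (Basic Multifilter).** Let $c>0$ and $\alpha_{\max}<1$. For all sufficiently large $C$ (depending on $c,\alpha_{\max}$) and all sufficiently large $C'$ (depending on $c,\alpha_{\max},C$) there is $K>0$ such that the following holds for all $d,k,\mu$, all $\tau\in(0,1)$ with $dk\log\frac1\tau\ge e^2$, all $0<\alpha\le\alpha_{\max}$, all $\rho\le c\sqrt{\gamma(\alpha)}$, all non-empty finite multisets $T\subset\mathbb R^d$, and all $k^2$-sparse polynomials $p$ of degree $l$ such that $\mathrm{Var}[p(G)]\le1$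 if $T$ is $\alpha$-good. Whatever choices are made, BasicMultifilter never gets stuck (the $t$ it looks for in step 2 or 3 always exists), and it returns one of the following: 1. "YES", and then (i) $\mathrm{Var}[p(T)]\le K\log^l(\frac1\alpha)\log^2(2+\log\frac1\alpha)$, and (ii) if $T$ is $\alpha$-good, then $|\mathbb E[p(G)]-\mathbb E[p(T)]|\le K\log^{l/2}(\frac1\alpha)\log(2+\log\frac1\alpha)$; 2. "NO", and then $T$ is not $\alpha$-good; 3. a list of one or two pairs $(T_i,\alpha_i)$, $T_i\subseteq T$, that satisfies the multifilter condition for $(T,\alpha)$. -/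

import Mathlib

open MeasureTheory ProbabilityTheory

noncomputable section

namespace SparseMultifilter

/-- The law `N(μ, I_d)` on `ℝ^d`.  Points of `ℝ^d` are functions `Fin d → ℝ`, whose Mathlib norm is
the `ℓ_∞` norm. -/
def gaussianLaw {d : ℕ} (μ : Fin d → ℝ) : Measure (Fin d → ℝ) :=
  Measure.pi fun i => gaussianReal (μ i) 1

/-- `c_m(i,j)`: the number of times that `m` appears among `i, j`. -/
def occurrences {d : ℕ} (i j m : Fin d) : ℕ :=
  (if i = m then 1 else 0) + (if j = m then 1 else 0)

/-- The degree-2 harmonic polynomial `h_A`: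
`√(2!) * h_A(x) = ∑_{i,j} A_{ij} ∏_m He_{c_m(i,j)}(x_m)`, where `He_a` is the (probabilists')
Hermite polynomial. -/
def harmonicQuadratic {d : ℕ} (A : Matrix (Fin d) (Fin d) ℝ) (x : Fin d → ℝ) : ℝ :=
  (∑ i, ∑ j, A i j * ∏ m, Polynomial.aeval (x m) (Polynomial.hermite (occurrences i j m)))
    / Real.sqrt 2

/-- `k²`-sparse polynomial functions of degree `l`: linear forms with at most `k²` non-zero
coefficients (`l = 1`), and harmonic quadratics `h_A` of a symmetric matrix `A` with at most `k²`
non-zero entries (`l = 2`). -/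
def IsSparsePoly {d : ℕ} (k l : ℕ) (p : (Fin d → ℝ) → ℝ) : Prop :=
  (l = 1 ∧ ∃ v : Fin d → ℝ, {i | v i ≠ 0}.ncard ≤ k ^ 2 ∧ p = fun x => ∑ i, v i * x i) ∨
  (l = 2 ∧ ∃ A : Matrix (Fin d) (Fin d) ℝ, A.IsSymm ∧
    {ij : Fin d × Fin d | A ij.1 ij.2 ≠ 0}.ncard ≤ k ^ 2 ∧ p = harmonicQuadratic A)

/-! Empirical quantities: `x` is drawn uniformly from a finite multiset `T`. -/

open scoped Classical in
/-- `Pr_{x ∈ T}[P x]`. -/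
def prob {d : ℕ} (T : Multiset (Fin d → ℝ)) (P : (Fin d → ℝ) → Prop) : ℝ :=
  (T.countP P : ℝ) / (T.card : ℝ)

/-- `E[p(T)]`. -/
def mean {d : ℕ} (T : Multiset (Fin d → ℝ)) (p : (Fin d → ℝ) → ℝ) : ℝ :=
  (T.map p).sum / (T.card : ℝ)

/-- `Var[p(T)]`. -/
def var {d : ℕ} (T : Multiset (Fin d → ℝ)) (p : (Fin d → ℝ) → ℝ) : ℝ :=
  mean T fun x => (p x - mean T p) ^ 2

/-- `γ = log((d k / α) log(1/τ))`. -/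
def logFactor (d k : ℕ) (α τ : ℝ) : ℝ :=
  Real.log ((d : ℝ) * (k : ℝ) / α * Real.log (1 / τ))

/-- `S` is representative for `G ∼ N(μ, I_d)`: the tail probabilities of every `k²`-sparse polynomial
(at every threshold `θ`) agree on `S` and on `G` up to `α³ / (100 k⁴ γ²)`. -/
def IsRepresentative {d : ℕ} (k : ℕ) (τ : ℝ) (μ : Fin d → ℝ) (α : ℝ)
    (S : Multiset (Fin d → ℝ)) : Prop :=
  ∀ (l : ℕ) (p : (Fin d → ℝ) → ℝ) (θ : ℝ), IsSparsePoly k l p →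
    |(gaussianLaw μ).real {x | θ ≤ p x} - prob S fun x => θ ≤ p x|
      ≤ α ^ 3 / (100 * (k : ℝ) ^ 4 * logFactor d k α τ ^ 2)

open scoped Classical in
/-- `T` is `α`-good with respect to `G ∼ N(μ, I_d)`, with bound `ρ` on its `ℓ_∞` diameter.
`S ∩ T` is the intersection of multisets (minimum of the multiplicities). -/
def IsGood {d : ℕ} (k : ℕ) (τ ρ : ℝ) (μ : Fin d → ℝ) (α : ℝ) (T : Multiset (Fin d → ℝ)) : Prop :=
  0 < α ∧ α ≤ 1 ∧
  (∃ S : Multiset (Fin d → ℝ), IsRepresentative k τ μ α S ∧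
    max ((1 - α / 6) * (S.card : ℝ)) (α * (T.card : ℝ)) ≤ ((S ∩ T).card : ℝ)) ∧
  ∀ x ∈ T, ∀ y ∈ T, ‖x - y‖ ≤ ρ

/-- The multifilter condition for `(T, α)`. -/
def MultifilterCondition {d : ℕ} (k : ℕ) (τ ρ : ℝ) (μ : Fin d → ℝ) (α : ℝ)
    (T : Multiset (Fin d → ℝ)) (Ls : List (Multiset (Fin d → ℝ) × ℝ)) : Prop :=
  (∀ q ∈ Ls, q.1 ≤ T ∧ 0 < q.2) ∧
  (Ls.map fun q => 1 / q.2 ^ 2).sum ≤ 1 / α ^ 2 ∧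
  (IsGood k τ ρ μ α T → ∃ q ∈ Ls, IsGood k τ ρ μ q.2 q.1)

/-! ### The algorithm -/

/-- The input parameters `k`, `l`, `α`, `τ` and the constants `C`, `C'` of `BasicMultifilter`. -/
structure Params where
  k : ℕ
  l : ℕ
  α : ℝ
  τ : ℝ
  C : ℝ
  C' : ℝ

/-- `R = (C log(1/α))^{l/2}`. -/
def Params.R (P : Params) : ℝ := (P.C * Real.log (1 / P.α)) ^ ((P.l : ℝ) / 2)

/-- `L = C R log(2 + log(1/α))`. -/
def Params.L (P : Params) : ℝ := P.C * P.R * Real.log (2 + Real.log (1 / P.α))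

/-- The distance of `y` to the interval `[a, b]`. -/
def distInterval (a b y : ℝ) : ℝ := max 0 (max (a - y) (y - b))

/-- The possible outputs of `BasicMultifilter`. -/
inductive Output (d : ℕ) where
  | yes : Output d
  | no : Output d
  | list : List (Multiset (Fin d → ℝ) × ℝ) → Output d

/-- The states of a run: at the start; after an interval `[a, a + L]` has been chosen; after it has
been found that there is no such interval; and after returning an output. -/
inductive State (d : ℕ) where
  | start : State d
  | interval : ℝ → State d
  | noInterval : State d
  | done : Output d → State d

/-- The diameter test: some two values of `p` on `T` are at least `(C (1 + k² γ / l))^{l/2}` apart. -/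
def DiameterTest {d : ℕ} (P : Params) (T : Multiset (Fin d → ℝ)) (p : (Fin d → ℝ) → ℝ) : Prop :=
  ∃ x ∈ T, ∃ y ∈ T,
    (P.C * (1 + (P.k : ℝ) ^ 2 * logFactor d P.k P.α P.τ / (P.l : ℝ))) ^ ((P.l : ℝ) / 2)
      ≤ |p x - p y|

/-- `[a, a + L]` contains at least a `(1 - α/2)`-fraction of the values of `p` on `T`. -/
def IsHeavy {d : ℕ} (P : Params) (T : Multiset (Fin d → ℝ)) (p : (Fin d → ℝ) → ℝ) (a : ℝ) : Prop :=
  1 - P.α / 2 ≤ prob T fun x => p x ∈ Set.Icc a (a + P.L)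

/-- The variance test: `Var[p(T)] ≤ C' (log(1/α))^l log²(2 + log(1/α))`. -/
def VarianceTest {d : ℕ} (P : Params) (T : Multiset (Fin d → ℝ)) (p : (Fin d → ℝ) → ℝ) : Prop :=
  var T p ≤ P.C' * Real.log (1 / P.α) ^ P.l * Real.log (2 + Real.log (1 / P.α)) ^ 2

/-- `t` is an admissible threshold for filtering around `[a, a + L]`. -/
def IsFilterThreshold {d : ℕ} (P : Params) (T : Multiset (Fin d → ℝ)) (p : (Fin d → ℝ) → ℝ)
    (a t : ℝ) : Prop :=
  2 * P.R < t ∧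
  32 / P.α * Real.exp (-((t - 2 * P.R) ^ (2 / (P.l : ℝ)) / P.C))
      + 2 * P.α ^ 2 / ((P.k : ℝ) ^ 2 * logFactor d P.k P.α P.τ) ^ 2
    < prob T fun x => t ≤ distInterval a (a + P.L) (p x)

open scoped Classical in
/-- The filtered set `T'`. -/
def filtered {d : ℕ} (P : Params) (T : Multiset (Fin d → ℝ)) (p : (Fin d → ℝ) → ℝ) (a t : ℝ) :
    Multiset (Fin d → ℝ) :=
  T.filter fun x => distInterval a (a + P.L) (p x) < t

/-- `α' = α ((1 - α/8) |T| / |T'| + α/8)`. -/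
def filteredAlpha {d : ℕ} (P : Params) (T T' : Multiset (Fin d → ℝ)) : ℝ :=
  P.α * ((1 - P.α / 8) * (T.card : ℝ) / (T'.card : ℝ) + P.α / 8)

open scoped Classical in
/-- `T₁ = {x ∈ T : p(x) > t - R}`. -/
def upper {d : ℕ} (P : Params) (T : Multiset (Fin d → ℝ)) (p : (Fin d → ℝ) → ℝ) (t : ℝ) :
    Multiset (Fin d → ℝ) :=
  T.filter fun x => t - P.R < p x

open scoped Classical in
/-- `T₂ = {x ∈ T : p(x) < t + R}`. -/
def lower {d : ℕ} (P : Params) (T : Multiset (Fin d → ℝ)) (p : (Fin d → ℝ) → ℝ) (t : ℝ) :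
    Multiset (Fin d → ℝ) :=
  T.filter fun x => p x < t + P.R

/-- `t` is an admissible threshold for splitting. -/
def IsSplitThreshold {d : ℕ} (P : Params) (T : Multiset (Fin d → ℝ)) (p : (Fin d → ℝ) → ℝ)
    (t : ℝ) : Prop :=
  ((upper P T p t).card : ℝ) ^ 2 + ((lower P T p t).card : ℝ) ^ 2
      ≤ (T.card : ℝ) ^ 2 * (1 - P.α / 100) ^ 2 ∧
  P.α * (T.card : ℝ) / 4
      ≤ (T.card : ℝ) - max ((upper P T p t).card : ℝ) ((lower P T p t).card : ℝ)

/-- `α_i = α (1 - α²/100) |T| / |T_i|`. -/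
def splitAlpha {d : ℕ} (P : Params) (T Ti : Multiset (Fin d → ℝ)) : ℝ :=
  P.α * (1 - P.α ^ 2 / 100) * (T.card : ℝ) / (Ti.card : ℝ)

/-- One step of `BasicMultifilter` on input `(p, T)`.  The algorithm is non-deterministic: it may
choose any suitable interval and any admissible threshold. Every run makes at most two steps. -/
inductive Step {d : ℕ} (P : Params) (T : Multiset (Fin d → ℝ)) (p : (Fin d → ℝ) → ℝ) :
    State d → State d → Prop where
  | reject : DiameterTest P T p → Step P T p .start (.done .no)
  | oneCluster (a : ℝ) : ¬ DiameterTest P T p → IsHeavy P T p a →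
      Step P T p .start (.interval a)
  | spread : ¬ DiameterTest P T p → (¬ ∃ a, IsHeavy P T p a) → Step P T p .start .noInterval
  | accept (a : ℝ) : VarianceTest P T p → Step P T p (.interval a) (.done .yes)
  | filter (a t : ℝ) : ¬ VarianceTest P T p → IsFilterThreshold P T p a t →
      Step P T p (.interval a)
        (.done (.list [(filtered P T p a t, filteredAlpha P T (filtered P T p a t))]))
  | split (t : ℝ) : IsSplitThreshold P T p t →
      Step P T p .noInterval
        (.done (.list [(upper P T p t, splitAlpha P T (upper P T p t)),
          (lower P T p t, splitAlpha P T (lower P T p t))]))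

/-- The states that a run of `BasicMultifilter` on `(p, T)` can reach. -/
def Reachable {d : ℕ} (P : Params) (T : Multiset (Fin d → ℝ)) (p : (Fin d → ℝ) → ℝ)
    (s : State d) : Prop :=
  Relation.ReflTransGen (Step P T p) .start s

/-- What an output guarantees; `K` is the constant hidden in the `O(·)`. -/
def Guarantee {d : ℕ} (K : ℝ) (ρ : ℝ) (μ : Fin d → ℝ) (P : Params) (T : Multiset (Fin d → ℝ))
    (p : (Fin d → ℝ) → ℝ) : Output d → Prop
  | .yes =>
      var T p ≤ K * (Real.log (1 / P.α) ^ P.l * Real.log (2 + Real.log (1 / P.α)) ^ 2) ∧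
      (IsGood P.k P.τ ρ μ P.α T →
        |(∫ x, p x ∂gaussianLaw μ) - mean T p|
          ≤ K * (Real.log (1 / P.α) ^ ((P.l : ℝ) / 2) * Real.log (2 + Real.log (1 / P.α))))
  | .no => ¬ IsGood P.k P.τ ρ μ P.α T
  | .list Ls =>
      (Ls.length = 1 ∨ Ls.length = 2) ∧ MultifilterCondition P.k P.τ ρ μ P.α T Ls

end SparseMultifilter

end

open MeasureTheory ProbabilityTheory

noncomputable section

namespace SparseMultifilter

/-! ### Quadratic functions of a standard normal variable -/

/-! Everything rests on a tail bound for `p(G)`. Rotation invariance diagonalizes `p(G)` as `m + ∑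
(aᵢ(yᵢ² - 1) + bᵢyᵢ)` with independent standard normal `yᵢ`. Its variance is `∑ (2aᵢ² + bᵢ²) ≤ 1`,
and Chernoff's bound gives `Pr[p(G) ≥ m + s] ≤ 2 exp(-s^{2/l}/4)` (`IsSparsePoly.tail`). A
representative `S` inherits this up to its accuracy. Goodness of `T` then moves to a filtered
multiset as long as the filter costs `S` much less than it costs `T` (`isGood_filter`).

"NO": a good `T` lies in a cube of radius `(16 + c)√γ` about `μ`, and a `k²`-sparse `p` of variance
at most one deviates there from its mean by at most `3k` times the `l`-th power of the radius
(`not_diameterTest`).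

"YES": a heavy interval contains both a value near `E[p(G)]` and a value near `E[p(T)]`, so the
means differ by at most its length plus the two small distances (`abs_integral_sub_mean_le`).

Filtering: if every threshold were inadmissible, the tails outside the heavy interval could be
integrated to bound `Var[p(T)]` by the variance test; the non-exponential part of the tail is
harmless because the diameter test has bounded the range of `p` (`exists_isFilterThreshold`). An
admissible threshold removes a fraction of `T` at least `32/α` times the fraction of `S` that is
lost.

Splitting: if every threshold fails, the upper tail `g` of `p` satisfies `g(next)² ≥ (7/5) g` at
each move of `2R` inwards, so it grows from `α/4` beyond `1/2` in `O(log log(1/α))` moves. The same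
holds from below. Without a heavy interval the two `α/4`-quantiles are more than `L` apart, so both
tails exceed `1/2` while still disjoint, a contradiction (`exists_isSplitThreshold`). After a split,
the part on the side of `E[p(G)]` keeps almost all of `S`.

The bound `α ≤ αmax < 1` keeps `log(1/α)` away from zero, so that absolute constants can be absorbed
into powers of it. -/

lemma one_le_one_sub_mul_exp {x : ℝ} (h1 : -(1 / 2) ≤ x) (h2 : x ≤ 1 / 2) :
    1 ≤ (1 - x) * Real.exp (x + x ^ 2) := by
  rcases le_or_gt 0 x with hx | hx
  · have := Real.quadratic_le_exp_of_nonneg (x := x + x ^ 2) (by positivity)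
    have h3 : 1 ≤ (1 - x) * (1 + (x + x ^ 2) + (x + x ^ 2) ^ 2 / 2) := by
      have : (1 - x) * (1 + (x + x ^ 2) + (x + x ^ 2) ^ 2 / 2)
        = 1 + x ^ 2 / 2 * ((1 - 2 * x) * (1 + x / 2) + x ^ 2 / 2 * (1 - 2 * x) + x / 2 * (1 - x)) := by
        ring
      rw [this]
      have : 0 ≤ 1 - 2 * x := by linarith
      have : 0 ≤ 1 - x := by linarith
      have : 0 ≤ x ^ 2 / 2 * ((1 - 2 * x) * (1 + x / 2) + x ^ 2 / 2 * (1 - 2 * x) + x / 2 * (1 - x)) := by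
        positivity
      linarith
    exact h3.trans (mul_le_mul_of_nonneg_left this (by linarith))
  · have := Real.add_one_le_exp (x + x ^ 2)
    have h3 : 1 ≤ (1 - x) * (x + x ^ 2 + 1) := by nlinarith [pow_pos (neg_pos.2 hx) 3]
    exact h3.trans (mul_le_mul_of_nonneg_left this (by linarith))

lemma exp_quadratic_mul_gaussianPDFReal {a : ℝ} (ha : a < 1 / 2) (b y : ℝ) :
    gaussianPDFReal 0 1 y * Real.exp (a * (y ^ 2 - 1) + b * y) =
      (√(2 * Real.pi))⁻¹ * Real.exp (b ^ 2 / (2 * (1 - 2 * a)) - a) *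
        Real.exp (-(1 / 2 - a) * (y - b / (1 - 2 * a)) ^ 2) := by
  have : (1 - 2 * a) ≠ 0 := by linarith
  rw [gaussianPDFReal_def]
  simp only [NNReal.coe_one, mul_one, sub_zero]
  rw [mul_assoc, mul_assoc, ← Real.exp_add, ← Real.exp_add]
  congr 2
  field_simp
  ring

lemma integrable_exp_quadratic {a : ℝ} (ha : a < 1 / 2) (b : ℝ) :
    Integrable (fun y => Real.exp (a * (y ^ 2 - 1) + b * y)) (gaussianReal 0 1) := by
  rw [gaussianReal_of_var_ne_zero _ one_ne_zero, gaussianPDF_def,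
    integrable_withDensity_iff_integrable_smul' (by fun_prop) (by simp)]
  simp only [ENNReal.toReal_ofReal (gaussianPDFReal_nonneg _ _ _), smul_eq_mul,
    exp_quadratic_mul_gaussianPDFReal ha]
  exact ((integrable_exp_neg_mul_sq (show 0 < 1 / 2 - a by linarith)).comp_sub_right _).const_mul _

/-- Completing the square evaluates the integral as `exp(b²/(2(1 - 2a)) - a) / √(1 - 2a)`. The bound
`-log(1 - x) ≤ x + x²` at `x = 2a` cancels the linear term `-a`, and what remains is at most the
exponential of the variance `2a² + b²`. -/
lemma integral_exp_quadratic_le {a : ℝ} (ha : |a| ≤ 1 / 4) (b : ℝ) :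
    ∫ y, Real.exp (a * (y ^ 2 - 1) + b * y) ∂gaussianReal 0 1 ≤ Real.exp (2 * a ^ 2 + b ^ 2) := by
  obtain ⟨h1, h2⟩ := abs_le.1 ha
  rw [integral_gaussianReal_eq_integral_smul one_ne_zero]
  simp only [smul_eq_mul, exp_quadratic_mul_gaussianPDFReal (show a < 1 / 2 by linarith)]
  rw [integral_const_mul, integral_sub_right_eq_self
    (fun y => Real.exp (-(1 / 2 - a) * y ^ 2)), integral_gaussian]
  have h3 : 0 < 1 - 2 * a := by linarith
  have h4 : √(Real.pi / (1 / 2 - a)) = √(2 * Real.pi) * (√(1 - 2 * a))⁻¹ := by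
    rw [← Real.sqrt_inv, ← Real.sqrt_mul (by positivity)]
    congr 1
    have : (1 / 2 - a) ≠ 0 := by linarith
    field_simp
  have h5 : (√(1 - 2 * a))⁻¹ ≤ Real.exp (a + 2 * a ^ 2) := by
    rw [← Real.sqrt_inv]
    apply Real.sqrt_le_iff.2 ⟨by positivity, ?_⟩
    rw [inv_le_iff_one_le_mul₀' h3, ← Real.exp_nat_mul]
    convert! one_le_one_sub_mul_exp (x := 2 * a) (by linarith) (by linarith) using 3
    push_cast; ring
  have h6 : b ^ 2 / (2 * (1 - 2 * a)) ≤ b ^ 2 := by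
    rw [div_le_iff₀ (by linarith)]
    nlinarith [sq_nonneg b]
  calc _ = Real.exp (b ^ 2 / (2 * (1 - 2 * a)) - a) * (√(1 - 2 * a))⁻¹ := by
        rw [h4]
        have : √(2 * Real.pi) ≠ 0 := by positivity
        field_simp
    _ ≤ Real.exp (b ^ 2 - a) * Real.exp (a + 2 * a ^ 2) := by gcongr
    _ = _ := by rw [← Real.exp_add]; ring_nf

lemma integral_pow_gaussianReal_eq_iteratedDeriv (n : ℕ) :
    ∫ y, y ^ n ∂gaussianReal 0 1 = iteratedDeriv n (fun t => Real.exp (t ^ 2 / 2)) 0 := by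
  have h : mgf (fun x : ℝ => x) (gaussianReal 0 1) = fun t => Real.exp (t ^ 2 / 2) := by
    rw [mgf_fun_id_gaussianReal]; simp
  rw [← h, iteratedDeriv_mgf_zero (by simp)]
  simp

/-- Derivatives of the moment generating function `exp(t²/2)` stay polynomial multiples of it;
iterating this rule yields the moments up to order four. -/
lemma deriv_mul_exp_sq_div_two {q q' : ℝ → ℝ} (h : ∀ t, HasDerivAt q (q' t) t) :
    deriv (fun t => q t * Real.exp (t ^ 2 / 2)) =
      fun t => (q' t + q t * t) * Real.exp (t ^ 2 / 2) := by
  ext t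
  have h1 : HasDerivAt (fun t : ℝ => t ^ 2 / 2) t t := by
    have := (hasDerivAt_pow 2 t).div_const 2
    simpa using this
  rw [((h t).fun_mul h1.exp).deriv]
  ring

lemma gaussianReal_moments :
    ∫ y, y ^ 2 ∂gaussianReal 0 1 = 1 ∧ ∫ y, y ^ 3 ∂gaussianReal 0 1 = 0 ∧
      ∫ y, y ^ 4 ∂gaussianReal 0 1 = 3 := by
  have d1 : deriv (fun t : ℝ => Real.exp (t ^ 2 / 2)) = fun t => t * Real.exp (t ^ 2 / 2) := by
    have := deriv_mul_exp_sq_div_two (q := fun _ => 1) (q' := fun _ => 0)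
      (fun t => hasDerivAt_const _ _)
    simpa using this
  have d2 := deriv_mul_exp_sq_div_two (q := fun t => t) (q' := fun _ => 1) (fun t => hasDerivAt_id t)
  have d3 := deriv_mul_exp_sq_div_two (q := fun t => 1 + t * t) (q' := fun t => 2 * t)
    (fun t => by
      convert! ((hasDerivAt_id t).mul (hasDerivAt_id t)).const_add 1 using 1
      simp; ring)
  have d4 := deriv_mul_exp_sq_div_two (q := fun t => 2 * t + (1 + t * t) * t)
    (q' := fun t => 3 + 3 * t ^ 2)
    (fun t => by
      convert! ((hasDerivAt_id t).const_mul 2).add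
        ((((hasDerivAt_id t).mul (hasDerivAt_id t)).const_add 1).mul (hasDerivAt_id t)) using 1
      simp; ring)
  simp only [integral_pow_gaussianReal_eq_iteratedDeriv, iteratedDeriv_succ, iteratedDeriv_zero, d1, d2,
    d3, d4]
  norm_num

lemma integrable_pow_gaussianReal (n : ℕ) :
    Integrable (fun y : ℝ => y ^ n) (gaussianReal 0 1) := by
  have := (memLp_id_gaussianReal (μ := 0) (v := 1) n).integrable_norm_pow'
  refine this.mono' (by fun_prop) (ae_of_all _ fun y => ?_)
  simp

lemma integral_quadratic_gaussianReal (a b : ℝ) :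
    ∫ y, (a * (y ^ 2 - 1) + b * y) ∂gaussianReal 0 1 = 0 := by
  have i1 : Integrable (fun y : ℝ => y) (gaussianReal 0 1) := by
    simpa using integrable_pow_gaussianReal 1
  have i2 : Integrable (fun y : ℝ => y ^ 2 - 1) (gaussianReal 0 1) :=
    (integrable_pow_gaussianReal 2).sub (integrable_const _)
  rw [integral_add (i2.const_mul _)
    (i1.const_mul _), integral_const_mul, integral_const_mul,
    integral_sub (integrable_pow_gaussianReal 2) (integrable_const _), gaussianReal_moments.1]
  simp

lemma memLp_quadratic_gaussianReal (a b : ℝ) :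
    MemLp (fun y : ℝ => a * (y ^ 2 - 1) + b * y) 2 (gaussianReal 0 1) := by
  rw [memLp_two_iff_integrable_sq (by fun_prop)]
  have : (fun y : ℝ => (a * (y ^ 2 - 1) + b * y) ^ 2) = fun y => a ^ 2 * y ^ 4 +
      2 * a * b * y ^ 3 + (b ^ 2 - 2 * a ^ 2) * y ^ 2 + (-2 * a * b) * y ^ 1 + a ^ 2 := by
    ext y; ring
  rw [this]
  have := integrable_pow_gaussianReal
  exact (((((this 4).const_mul _).add ((this 3).const_mul _)).add ((this 2).const_mul _)).add
    ((this 1).const_mul _)).add (integrable_const _)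

lemma variance_quadratic_gaussianReal (a b : ℝ) :
    variance (fun y : ℝ => a * (y ^ 2 - 1) + b * y) (gaussianReal 0 1) = 2 * a ^ 2 + b ^ 2 := by
  rw [variance_eq_integral (by fun_prop), integral_quadratic_gaussianReal]
  have h : (fun y : ℝ => (a * (y ^ 2 - 1) + b * y - 0) ^ 2) = fun y => (a ^ 2 * y ^ 4 +
      (2 * a * b * y ^ 3 + ((b ^ 2 - 2 * a ^ 2) * y ^ 2 + ((-2 * a * b) * y ^ 1 + a ^ 2)))) := by
    ext y; ring
  have i := integrable_pow_gaussianReal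
  obtain ⟨m2, m3, m4⟩ := gaussianReal_moments
  have e1 : ∀ c : ℝ, Integrable (fun y : ℝ => c * y ^ 1 + a ^ 2) (gaussianReal 0 1) :=
    fun c => ((i 1).const_mul c).add (integrable_const _)
  have e2 : ∀ c c' : ℝ, Integrable (fun y : ℝ => c' * y ^ 2 + (c * y ^ 1 + a ^ 2))
    (gaussianReal 0 1) := fun c c' => ((i 2).const_mul c').add (e1 c)
  have e3 : ∀ c c' c'' : ℝ, Integrable (fun y : ℝ => c'' * y ^ 3 + (c' * y ^ 2 +
    (c * y ^ 1 + a ^ 2))) (gaussianReal 0 1) := fun c c' c'' => ((i 3).const_mul c'').add (e2 c c')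
  rw [h, integral_add ((i 4).const_mul _) (e3 _ _ _), integral_add ((i 3).const_mul _) (e2 _ _),
    integral_add ((i 2).const_mul _) (e1 _), integral_add ((i 1).const_mul _) (integrable_const _)]
  simp only [integral_const_mul, m2, m3, m4]
  simp
  ring

/-! ### Quadratic functions of a standard normal vector -/

/-- `∑ᵢ (aᵢ (yᵢ² - 1) + bᵢ yᵢ)`. -/
def diagQuadratic {ι : Type*} [Fintype ι] (a b y : ι → ℝ) : ℝ :=
  ∑ i, (a i * (y i ^ 2 - 1) + b i * y i)

/-- The standard normal law on `ι → ℝ`. -/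
def stdNormal (ι : Type*) [Fintype ι] : Measure (ι → ℝ) :=
  Measure.pi fun _ => gaussianReal 0 1

instance {ι : Type*} [Fintype ι] : IsProbabilityMeasure (stdNormal ι) := by
  unfold stdNormal; infer_instance

instance {d : ℕ} (μ : Fin d → ℝ) : IsProbabilityMeasure (gaussianLaw μ) := by
  unfold gaussianLaw; infer_instance

section diagQuadratic

variable {ι : Type*} [Fintype ι] (a b : ι → ℝ)

lemma measurable_diagQuadratic : Measurable (diagQuadratic a b) := by
  unfold diagQuadratic; fun_prop

lemma integral_diagQuadratic : ∫ y, diagQuadratic a b y ∂stdNormal ι = 0 := by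
  unfold diagQuadratic stdNormal
  have h := fun i => (memLp_quadratic_gaussianReal (a i) (b i)).integrable (by norm_num)
  rw [integral_finsetSum _ fun i _ => integrable_comp_eval (i := i)
    (μ := fun _ : ι => gaussianReal 0 1) (f := fun y => a i * (y ^ 2 - 1) + b i * y) (h i)]
  refine Finset.sum_eq_zero fun i _ => ?_
  rw [integral_comp_eval (i := i) (μ := fun _ : ι => gaussianReal 0 1)
    (f := fun y => a i * (y ^ 2 - 1) + b i * y) (h i).aestronglyMeasurable,
    integral_quadratic_gaussianReal]

lemma integrable_diagQuadratic : Integrable (diagQuadratic a b) (stdNormal ι) := by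
  unfold diagQuadratic stdNormal
  exact integrable_finsetSum _ fun i _ => integrable_comp_eval (i := i)
    (μ := fun _ : ι => gaussianReal 0 1) (f := fun y => a i * (y ^ 2 - 1) + b i * y)
    ((memLp_quadratic_gaussianReal (a i) (b i)).integrable (by norm_num))

lemma variance_diagQuadratic :
    variance (diagQuadratic a b) (stdNormal ι) = ∑ i, (2 * a i ^ 2 + b i ^ 2) := by
  have := variance_sum_pi (μ := fun _ : ι => gaussianReal 0 1)
    (fun i => memLp_quadratic_gaussianReal (a i) (b i))
  simp only [variance_quadratic_gaussianReal] at this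
  rw [← this, stdNormal]
  congr 1
  ext y
  simp [diagQuadratic]

lemma mgf_diagQuadratic {t : ℝ} (h : ∀ i, |t * a i| ≤ 1 / 4) :
    Integrable (fun y => Real.exp (t * diagQuadratic a b y)) (stdNormal ι) ∧
    mgf (diagQuadratic a b) (stdNormal ι) t ≤
      Real.exp (t ^ 2 * ∑ i, (2 * a i ^ 2 + b i ^ 2)) := by
  have e : (fun y => Real.exp (t * diagQuadratic a b y)) = fun y : ι → ℝ =>
      ∏ i, Real.exp (t * a i * (y i ^ 2 - 1) + t * b i * y i) := by
    ext y
    rw [diagQuadratic, ← Real.exp_sum, Finset.mul_sum]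
    congr 1
    exact Finset.sum_congr rfl fun i _ => by ring
  unfold mgf
  rw [e, stdNormal]
  refine ⟨Integrable.fintype_prod (f := fun i y =>
    Real.exp (t * a i * (y ^ 2 - 1) + t * b i * y)) fun i => integrable_exp_quadratic ?_ _, ?_⟩
  · have := (abs_le.1 (h i)).2
    linarith
  · rw [integral_fintype_prod_eq_prod (fun i y =>
      Real.exp (t * a i * (y ^ 2 - 1) + t * b i * y)), Finset.mul_sum, Real.exp_sum]
    refine Finset.prod_le_prod (fun i _ => integral_nonneg fun y => (Real.exp_pos _).le)
      fun i _ => ?_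
    convert! integral_exp_quadratic_le (h i) (t * b i) using 2
    ring

variable {a b} in
-- Chernoff at the fixed parameter `1/4`: variance at most one forces `|aᵢ| ≤ 1`, so `1/4` is always
-- in the range of `mgf_diagQuadratic`.
lemma diagQuadratic_tail (h : ∑ i, (2 * a i ^ 2 + b i ^ 2) ≤ 1) (s : ℝ) :
    (stdNormal ι).real {y | s ≤ diagQuadratic a b y} ≤ 2 * Real.exp (-(s / 4)) := by
  have ha : ∀ i, |1 / 4 * a i| ≤ 1 / 4 := fun i => by
    have h1 : 2 * a i ^ 2 + b i ^ 2 ≤ 1 := (Finset.single_le_sum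
      (f := fun i => 2 * a i ^ 2 + b i ^ 2) (fun i _ => by positivity) (Finset.mem_univ i)).trans h
    have h2 : |a i| ≤ 1 := by
      rw [← sq_le_one_iff_abs_le_one]
      nlinarith [sq_nonneg (a i), sq_nonneg (b i)]
    rw [abs_mul, abs_of_pos (by norm_num : (0 : ℝ) < 1 / 4)]
    linarith
  obtain ⟨h1, h2⟩ := mgf_diagQuadratic a b ha
  refine (measure_ge_le_exp_mul_mgf s (by norm_num : (0 : ℝ) ≤ 1 / 4) h1).trans ?_
  have h3 : Real.exp ((1 / 4) ^ 2 * ∑ i, (2 * a i ^ 2 + b i ^ 2)) ≤ 2 := by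
    have : Real.exp ((1 / 4) ^ 2 * ∑ i, (2 * a i ^ 2 + b i ^ 2)) ≤ Real.exp (1 / 2) := by
      apply Real.exp_le_exp.2; linarith
    refine this.trans ?_
    rw [← Real.le_log_iff_exp_le (by norm_num)]
    linarith [Real.log_two_gt_d9]
  calc _ ≤ Real.exp (-(1 / 4) * s) * 2 := by gcongr; exact h2.trans h3
    _ = _ := by rw [mul_comm]; ring_nf

variable {b} in
-- Without quadratic terms every Chernoff parameter is allowed, and `s / 2` gives a Gaussian tail.
lemma diagQuadratic_zero_tail (h : ∑ i, b i ^ 2 ≤ 1) {s : ℝ} (hs : 0 ≤ s) :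
    (stdNormal ι).real {y | s ≤ diagQuadratic 0 b y} ≤ 2 * Real.exp (-(s ^ 2 / 4)) := by
  obtain ⟨h1, h2⟩ := mgf_diagQuadratic 0 b (t := s / 2) (fun i => by simp)
  refine (measure_ge_le_exp_mul_mgf s (by positivity : (0 : ℝ) ≤ s / 2) h1).trans ?_
  have h3 : Real.exp ((s / 2) ^ 2 * ∑ i, (2 * (0 : ι → ℝ) i ^ 2 + b i ^ 2)) ≤
      Real.exp (s ^ 2 / 4) := by
    apply Real.exp_le_exp.2
    simp only [Pi.zero_apply]
    have : s ^ 2 / 4 * ∑ i, b i ^ 2 ≤ s ^ 2 / 4 * 1 := by gcongr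
    norm_num
    linarith
  calc _ ≤ Real.exp (-(s / 2) * s) * Real.exp (s ^ 2 / 4) := by gcongr; exact h2.trans h3
    _ = Real.exp (-(s ^ 2 / 4)) := by rw [← Real.exp_add]; ring_nf
    _ ≤ _ := by linarith [Real.exp_pos (-(s ^ 2 / 4))]

end diagQuadratic

/-! ### Diagonalization of sparse polynomials -/

/-- Cauchy–Schwarz on the support of `f`. -/
lemma sum_abs_le_mul_sqrt {ι : Type*} [Fintype ι] {f : ι → ℝ} {k : ℕ}
    (h : {i | f i ≠ 0}.ncard ≤ k ^ 2) : ∑ i, |f i| ≤ k * √(∑ i, f i ^ 2) := by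
  classical
  have e : ∑ i, |f i| = ∑ i with f i ≠ 0, |f i| := by
    rw [Finset.sum_filter]
    refine Finset.sum_congr rfl fun i _ => ?_
    split_ifs with hi
    · rfl
    · simp [not_not.1 hi]
  have hc : ((Finset.univ.filter fun i => f i ≠ 0).card : ℝ) ≤ (k : ℝ) ^ 2 := by
    rw [Set.ncard_eq_toFinset_card'] at h
    simp only [Set.toFinset_ofPred] at h
    exact_mod_cast h
  have h1 : (∑ i with f i ≠ 0, |f i|) ^ 2 ≤ (k : ℝ) ^ 2 * ∑ i, f i ^ 2 := by
    refine (sq_sum_le_card_mul_sum_sq).trans ?_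
    simp only [sq_abs]
    gcongr
    · exact Finset.subset_univ _
  rw [e]
  calc _ ≤ √((k : ℝ) ^ 2 * ∑ i, f i ^ 2) := Real.le_sqrt_of_sq_le h1
    _ = _ := by rw [Real.sqrt_mul (by positivity), Real.sqrt_sq (by positivity)]

lemma prod_hermite_occurrences {d : ℕ} (x : Fin d → ℝ) (i j : Fin d) :
    ∏ m, Polynomial.aeval (x m) (Polynomial.hermite (occurrences i j m)) =
      x i * x j - if i = j then 1 else 0 := by
  have h2 : ∀ y : ℝ, Polynomial.aeval y (Polynomial.hermite 2) = y ^ 2 - 1 := fun y => by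
    rw [Polynomial.hermite_succ, Polynomial.hermite_one]
    simp [sq]
  by_cases hij : i = j
  · subst hij
    rw [Finset.prod_eq_single i]
    · have : occurrences i i i = 2 := by simp [occurrences]
      rw [this, h2, if_pos rfl, sq]
    · intro m _ hm
      simp [occurrences, hm.symm]
    · simp
  · have : ∀ m, Polynomial.aeval (x m) (Polynomial.hermite (occurrences i j m)) =
        (if i = m then x m else 1) * (if j = m then x m else 1) := by
      intro m
      unfold occurrences
      by_cases h1 : i = m
      · have : j ≠ m := fun h => hij (h1.trans h.symm)
        simp [h1, this]
      · by_cases h2 : j = m <;> simp [h1, h2]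
    simp only [this, Finset.prod_mul_distrib, Finset.prod_ite_eq, Finset.mem_univ, if_true, hij,
      if_false, sub_zero]

lemma harmonicQuadratic_eq {d : ℕ} (A : Matrix (Fin d) (Fin d) ℝ) (x : Fin d → ℝ) :
    harmonicQuadratic A x = (x ⬝ᵥ A.mulVec x - A.trace) / √2 := by
  unfold harmonicQuadratic
  congr 1
  simp only [prod_hermite_occurrences, mul_sub, Finset.sum_sub_distrib, mul_ite, mul_one, mul_zero,
    Finset.sum_ite_eq, Finset.mem_univ, if_true]
  simp only [dotProduct, Matrix.mulVec, Finset.mul_sum, Matrix.trace, Matrix.diag]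
  congr 1
  exact Finset.sum_congr rfl fun i _ => Finset.sum_congr rfl fun j _ => by ring

/-- Rotation invariance: independent standard normal coordinates in any orthonormal basis give the
same law. -/
lemma gaussianLaw_eq_map {d : ℕ} (μ : Fin d → ℝ)
    (e : OrthonormalBasis (Fin d) ℝ (EuclideanSpace ℝ (Fin d))) :
    gaussianLaw μ =
      (stdNormal (Fin d)).map fun y => μ + WithLp.ofLp (∑ i, y i • e i) := by
  have h1 : gaussianLaw μ = (stdNormal (Fin d)).map fun z => μ + z := by
    unfold gaussianLaw stdNormal
    have : (fun z : Fin d → ℝ => μ + z) = fun z i => μ i + z i := rfl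
    rw [this, Measure.pi_map_pi (f := fun i y => μ i + y) (fun i => by fun_prop)]
    congr 1
    ext1 i
    rw [gaussianReal_map_const_add, zero_add]
  have h2 : (stdNormal (Fin d)) = (stdGaussian (EuclideanSpace ℝ (Fin d))).map WithLp.ofLp := by
    rw [← map_pi_eq_stdGaussian, Measure.map_map (by fun_prop) (by fun_prop)]
    simp [Function.comp_def, stdNormal]
  rw [h1]
  conv_lhs => rw [h2, stdGaussian_eq_map_pi_orthonormalBasis e]
  rw [Measure.map_map (by fun_prop) (by fun_prop), Measure.map_map (by fun_prop) (by fun_prop)]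
  rfl

/-- After a change of variables that maps the standard normal law to `N(μ, I)`, `p` is the constant
`m` plus a diagonal quadratic. If it has variance at most one, it is bounded on cubes around `μ`. -/
def Diagonalizes {d : ℕ} (k l : ℕ) (μ : Fin d → ℝ) (p : (Fin d → ℝ) → ℝ) (m : ℝ)
    (a b : Fin d → ℝ) (φ : (Fin d → ℝ) → Fin d → ℝ) : Prop :=
  Measurable φ ∧ gaussianLaw μ = (stdNormal (Fin d)).map φ ∧
  (∀ y, p (φ y) = m + diagQuadratic a b y) ∧ Measurable p ∧ (l = 1 → a = 0) ∧
  (∑ i, (2 * a i ^ 2 + b i ^ 2) ≤ 1 → ∀ (z : Fin d → ℝ) (r : ℝ), 1 ≤ r → ‖z‖ ≤ r →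
    |p (μ + z) - m| ≤ 3 * k * r ^ l)

lemma diagonalizes_linear {d k : ℕ} (μ v : Fin d → ℝ) (hv : {i | v i ≠ 0}.ncard ≤ k ^ 2) :
    ∃ φ, Diagonalizes k 1 μ (fun x => ∑ i, v i * x i) (∑ i, v i * μ i) 0 v φ := by
  refine ⟨_, ?_, gaussianLaw_eq_map μ (EuclideanSpace.basisFun (Fin d) ℝ), fun y => ?_,
    by fun_prop, fun _ => rfl, fun h z r hr hz => ?_⟩
  · fun_prop
  · simp [diagQuadratic, mul_add, Finset.sum_add_distrib, Pi.single_apply]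
  · simp only [Pi.zero_apply, ne_eq, OfNat.ofNat_ne_zero, not_false_eq_true, zero_pow, mul_zero,
      zero_add] at h
    have h1 : |∑ i, v i * z i| ≤ ∑ i, |v i| * r := by
      refine (Finset.abs_sum_le_sum_abs _ _).trans (Finset.sum_le_sum fun i _ => ?_)
      rw [abs_mul]
      gcongr
      exact (norm_le_pi_norm z i).trans hz
    rw [← Finset.sum_mul] at h1
    have h2 : √(∑ i, v i ^ 2) ≤ 1 := Real.sqrt_le_one.2 h
    have h3 : ∑ i, |v i| ≤ k * 1 := (sum_abs_le_mul_sqrt hv).trans (by gcongr)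
    have h4 : (∑ i, v i * (μ + z) i) - ∑ i, v i * μ i = ∑ i, v i * z i := by
      simp [mul_add, Finset.sum_add_distrib]
    rw [h4, pow_one]
    have : (∑ i, |v i|) * r ≤ k * 1 * r := by gcongr
    have : (0 : ℝ) ≤ k * r := by positivity
    linarith


lemma exists_eigenbasis {d : ℕ} {A : Matrix (Fin d) (Fin d) ℝ} (hA : A.IsSymm) (μ : Fin d → ℝ) :
    ∃ (w : Fin d → ℝ) (E : Fin d → Fin d → ℝ),
      (∀ i j, E i ⬝ᵥ E j = if i = j then 1 else 0) ∧
      (∀ x, ∑ j, (x ⬝ᵥ E j) ^ 2 = ∑ i, x i ^ 2) ∧ (∀ j, A.mulVec (E j) = w j • E j) ∧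
      A.trace = ∑ j, w j ∧
      gaussianLaw μ = (stdNormal (Fin d)).map fun y => μ + ∑ i, y i • E i := by
  have h : A.IsHermitian := by
    rw [Matrix.IsHermitian, Matrix.conjTranspose_eq_transpose_of_trivial]
    exact hA
  have hin : ∀ x y : EuclideanSpace ℝ (Fin d), inner ℝ x y = x.ofLp ⬝ᵥ y.ofLp := fun x y => by
    simp [EuclideanSpace.inner_eq_star_dotProduct, dotProduct_comm]
  refine ⟨h.eigenvalues, fun j => (h.eigenvectorBasis j).ofLp, fun i j => ?_, fun x => ?_,
    fun j => ?_, ?_, ?_⟩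
  · rw [← hin, h.eigenvectorBasis.inner_eq_ite]
  · have := h.eigenvectorBasis.sum_sq_inner_left (WithLp.toLp 2 x)
    simp only [hin] at this
    rw [this, EuclideanSpace.real_norm_sq_eq]
  · exact h.mulVec_eigenvectorBasis j
  · simpa using h.trace_eq_sum_eigenvalues
  · rw [gaussianLaw_eq_map μ h.eigenvectorBasis]
    simp

/-- In an eigenbasis of `A` the variance is `‖A‖_F² + 2‖Aμ‖²`. Since `μ` enters `p(μ + z) - m` only
through `Aμ`, variance at most one bounds this difference independently of the size of `μ`. -/
lemma diagonalizes_harmonicQuadratic {d k : ℕ} (μ : Fin d → ℝ) {A : Matrix (Fin d) (Fin d) ℝ}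
    (hA : A.IsSymm) (hk : {ij : Fin d × Fin d | A ij.1 ij.2 ≠ 0}.ncard ≤ k ^ 2) :
    ∃ m a b φ, Diagonalizes k 2 μ (harmonicQuadratic A) m a b φ := by
  obtain ⟨w, E, hE, hP, hw, htr, hlaw⟩ := exists_eigenbasis hA μ
  have hsymm : ∀ x y : Fin d → ℝ, x ⬝ᵥ A.mulVec y = y ⬝ᵥ A.mulVec x := fun x y => by
    rw [Matrix.dotProduct_mulVec, ← Matrix.mulVec_transpose, hA.eq, dotProduct_comm]
  have s2 : √2 * √2 = 2 := Real.mul_self_sqrt (by norm_num)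
  have s2' : √2 ≠ 0 := by positivity
  have hexp : ∀ z : Fin d → ℝ, harmonicQuadratic A (μ + z) = (μ ⬝ᵥ A.mulVec μ) / √2 +
      ((z ⬝ᵥ A.mulVec z - A.trace) / √2 + √2 * (z ⬝ᵥ A.mulVec μ)) := fun z => by
    rw [harmonicQuadratic_eq, Matrix.mulVec_add, add_dotProduct, dotProduct_add, dotProduct_add,
      hsymm μ z]
    field_simp
    rw [sq, s2]
    ring
  have hmeas : Measurable (harmonicQuadratic A) := by
    have : harmonicQuadratic A = fun x => (x ⬝ᵥ A.mulVec x - A.trace) / √2 :=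
      funext (harmonicQuadratic_eq A)
    rw [this]
    unfold dotProduct Matrix.mulVec dotProduct
    fun_prop
  -- Both sides are the squared Frobenius norm: `w j ^ 2 = ‖A E_j‖²`, then Parseval is applied to
  -- each row of `A`.
  have hw2 : ∑ j, w j ^ 2 = ∑ ij : Fin d × Fin d, A ij.1 ij.2 ^ 2 := by
    have h1 : ∀ j, w j ^ 2 = ∑ i, (A i ⬝ᵥ E j) ^ 2 := fun j => by
      have : ∑ i, (A i ⬝ᵥ E j) ^ 2 = ∑ i, (w j * E j i) ^ 2 := by
        refine Finset.sum_congr rfl fun i _ => ?_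
        have := congrFun (hw j) i
        simp only [Matrix.mulVec, Pi.smul_apply, smul_eq_mul] at this
        rw [this]
      rw [this]
      have h2 := hE j j
      simp only [dotProduct, if_true] at h2
      simp only [← sq] at h2
      simp only [mul_pow, ← Finset.mul_sum, h2, mul_one]
    simp only [h1]
    rw [Finset.sum_comm, Fintype.sum_prod_type]
    exact Finset.sum_congr rfl fun i _ => hP (A i)
  refine ⟨(μ ⬝ᵥ A.mulVec μ) / √2, fun j => w j / √2, fun j => √2 * (A.mulVec μ ⬝ᵥ E j),
    fun y => μ + ∑ i, y i • E i, by fun_prop, hlaw, fun y => ?_, hmeas, by norm_num, ?_⟩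
  · rw [hexp]
    have h1 : A.mulVec (∑ i, y i • E i) = ∑ i, (y i * w i) • E i := by
      rw [Matrix.mulVec_sum]
      exact Finset.sum_congr rfl fun i _ => by rw [Matrix.mulVec_smul, hw, smul_smul]
    have h2 : (∑ i, y i • E i) ⬝ᵥ A.mulVec (∑ i, y i • E i) = ∑ i, w i * y i ^ 2 := by
      rw [h1, sum_dotProduct]
      refine Finset.sum_congr rfl fun i _ => ?_
      rw [dotProduct_sum, Finset.sum_eq_single i]
      · rw [smul_dotProduct, dotProduct_smul, hE]
        simp; ring
      · intro j _ hj
        rw [smul_dotProduct, dotProduct_smul, hE]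
        simp [hj.symm]
      · simp
    have h3 : (∑ i, y i • E i) ⬝ᵥ A.mulVec μ = ∑ i, y i * (A.mulVec μ ⬝ᵥ E i) := by
      rw [sum_dotProduct]
      exact Finset.sum_congr rfl fun i _ => by
        rw [smul_dotProduct, dotProduct_comm, smul_eq_mul]
    rw [h2, h3, htr, ← Finset.sum_sub_distrib, Finset.sum_div, Finset.mul_sum,
      ← Finset.sum_add_distrib]
    unfold diagQuadratic
    congr 1
    exact Finset.sum_congr rfl fun i _ => by ring
  · intro h z r hr hz
    have h' : ∑ ij : Fin d × Fin d, A ij.1 ij.2 ^ 2 + 2 * ∑ i, (A.mulVec μ) i ^ 2 ≤ 1 := by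
      rw [← hw2, ← hP (A.mulVec μ), Finset.mul_sum, ← Finset.sum_add_distrib]
      refine le_of_eq_of_le (Finset.sum_congr rfl fun j _ => ?_) h
      rw [div_pow, mul_pow, sq √2, s2]
      ring
    have hr0 : 0 ≤ r := by linarith
    have hz' : ∀ i, |z i| ≤ r := fun i => (norm_le_pi_norm z i).trans hz
    have hA1 : ∑ ij : Fin d × Fin d, |A ij.1 ij.2| ≤ k := by
      refine (sum_abs_le_mul_sqrt hk).trans ?_
      have : √(∑ ij : Fin d × Fin d, A ij.1 ij.2 ^ 2) ≤ 1 := Real.sqrt_le_one.2 (by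
        have : 0 ≤ ∑ i, (A.mulVec μ) i ^ 2 := Finset.sum_nonneg fun i _ => sq_nonneg _
        linarith)
      calc _ ≤ (k : ℝ) * 1 := by gcongr
        _ = k := mul_one _
    -- `Aμ` vanishes at every zero row of `A`, so it inherits the sparsity of `A`.
    have hrow : {i | A.mulVec μ i ≠ 0}.ncard ≤ k ^ 2 := by
      refine le_trans ?_ hk
      refine (Set.ncard_le_ncard (t := Prod.fst '' {ij : Fin d × Fin d | A ij.1 ij.2 ≠ 0}) ?_
        (Set.toFinite _)).trans (Set.ncard_image_le (Set.toFinite _))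
      intro i hi
      obtain ⟨j, _, hj⟩ := Finset.exists_ne_zero_of_sum_ne_zero (s := Finset.univ)
        (f := fun j => A i j * μ j) hi
      exact ⟨(i, j), left_ne_zero_of_mul hj, rfl⟩
    have hq : √2 * ∑ i, |A.mulVec μ i| ≤ k := by
      have h1 : √2 * √(∑ i, A.mulVec μ i ^ 2) ≤ 1 := by
        rw [← Real.sqrt_mul (by norm_num)]
        refine Real.sqrt_le_one.2 ?_
        have : 0 ≤ ∑ ij : Fin d × Fin d, A ij.1 ij.2 ^ 2 := Finset.sum_nonneg fun i _ => sq_nonneg _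
        linarith
      calc _ ≤ √2 * (k * √(∑ i, A.mulVec μ i ^ 2)) := by
            gcongr; exact sum_abs_le_mul_sqrt hrow
        _ = k * (√2 * √(∑ i, A.mulVec μ i ^ 2)) := by ring
        _ ≤ k * 1 := by gcongr
        _ = k := mul_one _
    have hzz : |z ⬝ᵥ A.mulVec z| ≤ r ^ 2 * k := by
      have : z ⬝ᵥ A.mulVec z = ∑ ij : Fin d × Fin d, z ij.1 * A ij.1 ij.2 * z ij.2 := by
        rw [Fintype.sum_prod_type]
        simp only [dotProduct, Matrix.mulVec, Finset.mul_sum, mul_assoc]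
      rw [this]
      refine (Finset.abs_sum_le_sum_abs _ _).trans ?_
      calc _ ≤ ∑ ij : Fin d × Fin d, r ^ 2 * |A ij.1 ij.2| := Finset.sum_le_sum fun ij _ => by
            rw [abs_mul, abs_mul]
            calc _ ≤ r * |A ij.1 ij.2| * r := by gcongr <;> exact hz' _
              _ = _ := by ring
        _ ≤ _ := by rw [← Finset.mul_sum]; gcongr
    have htr' : |A.trace| ≤ k := by
      refine le_trans ?_ hA1
      refine (Finset.abs_sum_le_sum_abs _ _).trans ?_
      rw [Fintype.sum_prod_type]
      exact Finset.sum_le_sum fun i _ =>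
        Finset.single_le_sum (f := fun j => |A i j|) (fun j _ => abs_nonneg _) (Finset.mem_univ i)
    have hzm : |√2 * (z ⬝ᵥ A.mulVec μ)| ≤ r * k := by
      rw [abs_mul, abs_of_nonneg (Real.sqrt_nonneg 2)]
      have : |z ⬝ᵥ A.mulVec μ| ≤ r * ∑ i, |A.mulVec μ i| := by
        rw [Finset.mul_sum]
        refine (Finset.abs_sum_le_sum_abs _ _).trans (Finset.sum_le_sum fun i _ => ?_)
        rw [abs_mul]
        gcongr
        exact hz' i
      calc _ ≤ √2 * (r * ∑ i, |A.mulVec μ i|) := by gcongr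
        _ = r * (√2 * ∑ i, |A.mulVec μ i|) := by ring
        _ ≤ r * k := by gcongr
    have hdiv : |(z ⬝ᵥ A.mulVec z - A.trace) / √2| ≤ r ^ 2 * k + k := by
      rw [abs_div, abs_of_nonneg (Real.sqrt_nonneg 2)]
      refine (div_le_self (abs_nonneg _) (Real.one_le_sqrt.2 (by norm_num))).trans ?_
      exact (abs_sub _ _).trans (add_le_add hzz htr')
    rw [hexp, add_sub_cancel_left]
    refine (abs_add_le _ _).trans ((add_le_add hdiv hzm).trans ?_)
    have hk0 : (0 : ℝ) ≤ k := by positivity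
    nlinarith [mul_nonneg hk0 (sub_nonneg.2 hr), mul_nonneg (mul_nonneg hk0 (sub_nonneg.2 hr)) hr0]

lemma IsSparsePoly.exists_diagonalizes {d k l : ℕ} {p : (Fin d → ℝ) → ℝ} (hp : IsSparsePoly k l p)
    (μ : Fin d → ℝ) : ∃ m a b φ, Diagonalizes k l μ p m a b φ := by
  rcases hp with ⟨rfl, v, hv, rfl⟩ | ⟨rfl, A, hA, hk, rfl⟩
  · obtain ⟨φ, h⟩ := diagonalizes_linear μ v hv
    exact ⟨_, _, _, φ, h⟩
  · exact diagonalizes_harmonicQuadratic μ hA hk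

lemma IsSparsePoly.degree_eq {d k l : ℕ} {p : (Fin d → ℝ) → ℝ} (hp : IsSparsePoly k l p) :
    l = 1 ∨ l = 2 := by
  rcases hp with ⟨h, -⟩ | ⟨h, -⟩ <;> simp [h]

lemma IsSparsePoly.neg {d k l : ℕ} {p : (Fin d → ℝ) → ℝ} (hp : IsSparsePoly k l p) :
    IsSparsePoly k l fun x => -p x := by
  rcases hp with ⟨rfl, v, hv, rfl⟩ | ⟨rfl, A, hA, hk, rfl⟩
  · refine Or.inl ⟨rfl, -v, by simpa using hv, ?_⟩
    ext x; simp
  · refine Or.inr ⟨rfl, -A, hA.neg, by simpa using hk, ?_⟩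
    ext x
    simp [harmonicQuadratic, neg_div]

lemma Diagonalizes.integral_variance {d k l : ℕ} {p : (Fin d → ℝ) → ℝ} {μ : Fin d → ℝ} {m a b φ}
    (h : Diagonalizes (d := d) k l μ p m a b φ) :
    ∫ x, p x ∂gaussianLaw μ = m ∧
      variance p (gaussianLaw μ) = ∑ i, (2 * a i ^ 2 + b i ^ 2) := by
  obtain ⟨hφ, hlaw, hpφ, hp, -, -⟩ := h
  rw [hlaw, integral_map hφ.aemeasurable hp.aestronglyMeasurable, variance_map hp.aemeasurable
    hφ.aemeasurable]
  constructor
  · simp only [hpφ]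
    rw [integral_add (integrable_const _) (integrable_diagQuadratic a b), integral_diagQuadratic]
    simp
  · have : p ∘ φ = fun y => m + diagQuadratic a b y := funext hpφ
    rw [this, variance_const_add (measurable_diagQuadratic a b).aestronglyMeasurable,
      variance_diagQuadratic]

lemma IsSparsePoly.tail {d k l : ℕ} {p : (Fin d → ℝ) → ℝ} (hp : IsSparsePoly k l p)
    {μ : Fin d → ℝ} (hvar : variance p (gaussianLaw μ) ≤ 1) {s : ℝ} (hs : 0 ≤ s) :
    (gaussianLaw μ).real {x | ∫ y, p y ∂gaussianLaw μ + s ≤ p x} ≤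
      2 * Real.exp (-(s ^ (2 / (l : ℝ)) / 4)) := by
  obtain ⟨m, a, b, φ, h⟩ := hp.exists_diagonalizes μ
  obtain ⟨h1, h2⟩ := Diagonalizes.integral_variance h
  obtain ⟨hφ, hlaw, hpφ, hpm, hl, -⟩ := h
  rw [h2] at hvar
  have : (gaussianLaw μ).real {x | m + s ≤ p x} =
      (stdNormal (Fin d)).real {y | s ≤ diagQuadratic a b y} := by
    rw [hlaw, map_measureReal_apply hφ (measurableSet_le measurable_const hpm)]
    congr 1
    ext y
    simp [hpφ]
  rw [h1, this]
  rcases hp.degree_eq with rfl | rfl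
  · obtain rfl := hl rfl
    simpa using diagQuadratic_zero_tail (b := b) (by simpa using hvar) hs
  · simpa using diagQuadratic_tail hvar s

lemma IsSparsePoly.abs_sub_integral_le {d k l : ℕ} {p : (Fin d → ℝ) → ℝ} (hp : IsSparsePoly k l p)
    {μ : Fin d → ℝ} (hvar : variance p (gaussianLaw μ) ≤ 1) {x : Fin d → ℝ} {r : ℝ} (hr : 1 ≤ r)
    (hx : ‖x - μ‖ ≤ r) : |p x - ∫ y, p y ∂gaussianLaw μ| ≤ 3 * k * r ^ l := by
  obtain ⟨m, a, b, φ, h⟩ := hp.exists_diagonalizes μ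
  obtain ⟨h1, h2⟩ := Diagonalizes.integral_variance h
  have := h.2.2.2.2.2 (h2 ▸ hvar) (x - μ) r hr hx
  rwa [add_sub_cancel, ← h1] at this

lemma isSparsePoly_eval {d k : ℕ} (hk : 1 ≤ k) (i : Fin d) :
    IsSparsePoly k 1 fun x : Fin d → ℝ => x i := by
  refine Or.inl ⟨rfl, Pi.single i 1, ?_, ?_⟩
  · have : {j | (Pi.single i 1 : Fin d → ℝ) j ≠ 0} = {i} := by
      ext j; simp [Pi.single_apply]
    rw [this, Set.ncard_singleton]
    exact Nat.one_le_pow _ _ hk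
  · ext x; simp [Pi.single_apply]

lemma gaussianLaw_eval {d : ℕ} (μ : Fin d → ℝ) (i : Fin d) :
    ∫ x, x i ∂gaussianLaw μ = μ i ∧ variance (fun x => x i) (gaussianLaw μ) = 1 := by
  have hm := measurePreserving_eval (fun j => gaussianReal (μ j) 1) i
  constructor
  · have := integral_comp_eval (i := i) (μ := fun j => gaussianReal (μ j) 1) (f := fun y => y)
      (by fun_prop)
    simpa [gaussianLaw] using this
  · have := hm.variance_fun_comp (f := fun y => y) (by fun_prop)
    simpa [gaussianLaw] using this

/-! ### Empirical probabilities -/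

section prob

variable {d : ℕ} {S T : Multiset (Fin d → ℝ)} {P Q : (Fin d → ℝ) → Prop}

lemma card_pos_of_ne_zero (hT : T ≠ 0) : (0 : ℝ) < T.card := by
  exact_mod_cast Multiset.card_pos.2 hT

lemma card_filter_eq [DecidablePred P] (hT : T ≠ 0) : ((T.filter P).card : ℝ) = prob T P * T.card := by
  have := card_pos_of_ne_zero hT
  rw [prob, Multiset.countP_eq_card_filter]
  field_simp
  congr!

lemma prob_nonneg : 0 ≤ prob T P := by unfold prob; positivity

lemma prob_eq_zero (h : ∀ x ∈ T, ¬P x) : prob T P = 0 := by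
  classical
  simp [prob, Multiset.countP_eq_zero.2 h]

lemma prob_mono (h : ∀ x ∈ T, P x → Q x) : prob T P ≤ prob T Q := by
  classical
  unfold prob
  gcongr
  simp only [Multiset.countP_eq_card_filter]
  refine Multiset.card_le_card (Multiset.le_filter.2 ⟨Multiset.filter_le _ _, fun x hx => ?_⟩)
  rw [Multiset.mem_filter] at hx
  exact h x hx.1 hx.2

lemma prob_add_prob_not (hT : T ≠ 0) : prob T P + prob T (fun x => ¬P x) = 1 := by
  classical
  have := card_pos_of_ne_zero hT
  have h := Multiset.card_eq_countP_add_countP (p := P) T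
  unfold prob
  rw [← add_div, div_eq_one_iff_eq this.ne', h]
  push_cast
  congr!

lemma prob_le_one : prob T P ≤ 1 := by
  rcases eq_or_ne T 0 with rfl | hT
  · simp [prob]
  · linarith [prob_add_prob_not (P := P) hT, prob_nonneg (T := T) (P := fun x => ¬P x)]

lemma prob_or_le : prob T (fun x => P x ∨ Q x) ≤ prob T P + prob T Q := by
  classical
  unfold prob
  rw [← add_div]
  gcongr
  induction T using Multiset.induction_on with
  | empty => simp
  | cons a s ih =>
    by_cases hP : P a <;> by_cases hQ : Q a <;> simp [hP, hQ] at ih ⊢ <;> linarith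

lemma exists_mem_and_of_one_lt (h : 1 < prob T P + prob T Q) : ∃ x ∈ T, P x ∧ Q x := by
  rcases eq_or_ne T 0 with rfl | hT
  · simp [prob] at h
    linarith
  by_contra! hn
  have h1 : prob T P ≤ prob T fun x => ¬Q x := prob_mono fun x hx hp => hn x hx hp
  linarith [prob_add_prob_not (P := Q) hT]

end prob

/-! ### Representative and good multisets -/

section good

variable {d k : ℕ} {τ : ℝ}

/-- The assumption `d k log(1/τ) ≥ e²` keeps `γ ≥ 2` at every level up to one; hence the accuracy
increases with the level, and representativeness passes to larger levels. -/
lemma logFactor_antitone {α α' : ℝ} (hdk : Real.exp 2 ≤ (d : ℝ) * (k : ℝ) * Real.log (1 / τ))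
    (hα : 0 < α) (h : α ≤ α') (h1 : α' ≤ 1) :
    2 ≤ logFactor d k α' τ ∧ logFactor d k α' τ ≤ logFactor d k α τ := by
  have e2 := Real.exp_pos 2
  have hα' : 0 < α' := hα.trans_le h
  have e : ∀ β : ℝ, (d : ℝ) * k / β * Real.log (1 / τ) = d * k * Real.log (1 / τ) / β :=
    fun β => by ring
  have hpos : 0 < (d : ℝ) * k * Real.log (1 / τ) := e2.trans_le hdk
  unfold logFactor
  simp only [e]
  constructor
  · rw [Real.le_log_iff_exp_le (by positivity)]
    rw [le_div_iff₀ hα']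
    nlinarith
  · gcongr

lemma one_le_of_exp_two_le (hdk : Real.exp 2 ≤ (d : ℝ) * (k : ℝ) * Real.log (1 / τ)) : 1 ≤ k := by
  rw [Nat.one_le_iff_ne_zero]
  rintro rfl
  have := Real.exp_pos 2
  simp at hdk
  linarith

/-- The accuracy of a representative multiset. -/
def accuracy (d k : ℕ) (τ α : ℝ) : ℝ := α ^ 3 / (100 * (k : ℝ) ^ 4 * logFactor d k α τ ^ 2)

lemma accuracy_mono {α α' : ℝ} (hdk : Real.exp 2 ≤ (d : ℝ) * (k : ℝ) * Real.log (1 / τ))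
    (hα : 0 < α) (h : α ≤ α') (h1 : α' ≤ 1) : accuracy d k τ α ≤ accuracy d k τ α' := by
  obtain ⟨h2, h3⟩ := logFactor_antitone hdk hα h h1
  have := one_le_of_exp_two_le hdk
  have : 0 ≤ α' ^ 3 := pow_nonneg (hα.le.trans h) 3
  unfold accuracy
  gcongr

lemma accuracy_le {α : ℝ} (hdk : Real.exp 2 ≤ (d : ℝ) * (k : ℝ) * Real.log (1 / τ))
    (hα : 0 < α) (h1 : α ≤ 1) : accuracy d k τ α ≤ α ^ 3 / 400 := by
  have h2 := (logFactor_antitone hdk hα le_rfl h1).1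
  have : (1 : ℝ) ≤ k := by exact_mod_cast one_le_of_exp_two_le hdk
  have : 1 ≤ (k : ℝ) ^ 4 := one_le_pow₀ this
  unfold accuracy
  gcongr
  nlinarith

variable {μ : Fin d → ℝ} {α : ℝ} {S T : Multiset (Fin d → ℝ)}

lemma IsRepresentative.mono {α' : ℝ} (hS : IsRepresentative k τ μ α S)
    (hdk : Real.exp 2 ≤ (d : ℝ) * (k : ℝ) * Real.log (1 / τ))
    (hα : 0 < α) (h : α ≤ α') (h1 : α' ≤ 1) : IsRepresentative k τ μ α' S :=
  fun l p θ hp => (hS l p θ hp).trans (accuracy_mono hdk hα h h1)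

section tail

variable {l : ℕ} {p : (Fin d → ℝ) → ℝ}

/-- A bound for the one-sided tails of `p` on a representative multiset. -/
def tailBound (d k l : ℕ) (τ α s : ℝ) : ℝ :=
  2 * Real.exp (-(s ^ (2 / (l : ℝ)) / 4)) + accuracy d k τ α

lemma IsRepresentative.prob_ge_le (hS : IsRepresentative k τ μ α S) (hp : IsSparsePoly k l p)
    (hvar : variance p (gaussianLaw μ) ≤ 1) {s : ℝ} (hs : 0 ≤ s) :
    (prob S fun x => ∫ y, p y ∂gaussianLaw μ + s ≤ p x) ≤ tailBound d k l τ α s := by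
  have h1 := (abs_le.1 (hS l p (∫ y, p y ∂gaussianLaw μ + s) hp)).1
  have h2 := hp.tail hvar hs
  unfold tailBound accuracy
  linarith

lemma IsRepresentative.prob_le_le (hS : IsRepresentative k τ μ α S) (hp : IsSparsePoly k l p)
    (hvar : variance p (gaussianLaw μ) ≤ 1) {s : ℝ} (hs : 0 ≤ s) :
    (prob S fun x => p x ≤ ∫ y, p y ∂gaussianLaw μ - s) ≤ tailBound d k l τ α s := by
  have h := hS.prob_ge_le hp.neg (by rwa [variance_fun_neg]) hs
  rw [integral_neg] at h
  refine le_trans (prob_mono fun x _ hx => ?_) h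
  linarith

lemma IsRepresentative.prob_abs_ge_le (hS : IsRepresentative k τ μ α S) (hp : IsSparsePoly k l p)
    (hvar : variance p (gaussianLaw μ) ≤ 1) {s : ℝ} (hs : 0 ≤ s) :
    (prob S fun x => s ≤ |p x - ∫ y, p y ∂gaussianLaw μ|) ≤ 2 * tailBound d k l τ α s := by
  have h1 := hS.prob_ge_le hp hvar hs
  have h2 := hS.prob_le_le hp hvar hs
  refine le_trans (prob_mono (Q := fun x => ∫ y, p y ∂gaussianLaw μ + s ≤ p x ∨
    p x ≤ ∫ y, p y ∂gaussianLaw μ - s) fun x _ hx => ?_) (prob_or_le.trans (by linarith))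
  rcases le_abs.1 hx with h | h
  · left; linarith
  · right; linarith

/-- Outside of a small fraction of a representative multiset, `p` is within `16` of its mean. -/
lemma IsRepresentative.prob_abs_ge_sixteen_le (hS : IsRepresentative k τ μ α S)
    (hp : IsSparsePoly k l p) (hvar : variance p (gaussianLaw μ) ≤ 1)
    (hdk : Real.exp 2 ≤ (d : ℝ) * (k : ℝ) * Real.log (1 / τ)) (hα : 0 < α) (h1 : α ≤ 1) :
    (prob S fun x => 16 ≤ |p x - ∫ y, p y ∂gaussianLaw μ|) ≤ 1 / 4 := by
  refine (hS.prob_abs_ge_le hp hvar (by norm_num)).trans ?_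
  unfold tailBound
  have h2 := accuracy_le hdk hα h1
  have h3 : α ^ 3 ≤ 1 := pow_le_one₀ hα.le h1
  -- The value `16` is dictated by `l = 2`, where the exponent is `16 / 4 = 4`; for `l = 1` it is
  -- `64`.
  have h4 : Real.exp (-((16 : ℝ) ^ (2 / (l : ℝ)) / 4)) ≤ 1 / 32 := by
    have : Real.exp (-((16 : ℝ) ^ (2 / (l : ℝ)) / 4)) ≤ Real.exp (-4) := by
      apply Real.exp_le_exp.2
      rcases hp.degree_eq with rfl | rfl <;> norm_num
    refine this.trans ?_
    rw [← Real.le_log_iff_exp_le (by norm_num), show (1 / 32 : ℝ) = (2 ^ 5)⁻¹ by norm_num,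
      Real.log_inv, Real.log_pow]
    push_cast
    linarith [Real.log_two_lt_d9]
  linarith

end tail

variable {ρ : ℝ}

open scoped Classical in
/-- Goodness passes to a filtered multiset that loses few elements of `S`. -/
lemma isGood_filter {α' β : ℝ} {P : (Fin d → ℝ) → Prop}
    (hdk : Real.exp 2 ≤ (d : ℝ) * (k : ℝ) * Real.log (1 / τ))
    (hα : 0 < α) (hα1 : α ≤ 1) (hS : IsRepresentative k τ μ α S)
    (hST : max ((1 - α / 6) * (S.card : ℝ)) (α * (T.card : ℝ)) ≤ ((S ∩ T).card : ℝ))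
    (hdiam : ∀ x ∈ T, ∀ y ∈ T, ‖x - y‖ ≤ ρ) (hT : T.filter P ≠ 0)
    (hβ : (prob S fun x => ¬P x) ≤ β) (hαα' : α ≤ α')
    (h1 : α' * (T.filter P).card ≤ α * T.card * (1 - 6 / 5 * β)) (h2 : β ≤ (α' - α) / 6) :
    IsGood k τ ρ μ α' (T.filter P) := by
  obtain ⟨hS1, hS2⟩ := max_le_iff.1 hST
  have hT' := card_pos_of_ne_zero hT
  have hTpos : (0 : ℝ) < T.card := hT'.trans_le (by
    exact_mod_cast Multiset.card_le_card (Multiset.filter_le _ _))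
  have hSne : S ≠ 0 := by
    rintro rfl
    have : 0 < α * T.card := by positivity
    simp at hS2
    linarith
  have hSpos := card_pos_of_ne_zero hSne
  have hβ0 : 0 ≤ β := prob_nonneg.trans hβ
  have key : ((S ∩ T).card : ℝ) - β * S.card ≤ ((S ∩ T.filter P).card : ℝ) := by
    have e1 : ((S ∩ T).card : ℝ) =
        ((S ∩ T).filter P).card + ((S ∩ T).filter fun x => ¬P x).card := by
      rw [← Nat.cast_add, ← Multiset.card_add, Multiset.filter_add_not]
    have e2 : (((S ∩ T).filter fun x => ¬P x).card : ℝ) ≤ (S.filter fun x => ¬P x).card := by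
      exact_mod_cast Multiset.card_le_card (Multiset.filter_le_filter _ Multiset.inter_le_left)
    have e3 : (((S ∩ T).filter P).card : ℝ) ≤ (S ∩ T.filter P).card := by
      exact_mod_cast Multiset.card_le_card (Multiset.le_inter
        ((Multiset.filter_le _ _).trans Multiset.inter_le_left)
        (Multiset.filter_le_filter _ Multiset.inter_le_right))
    rw [card_filter_eq hSne] at e2
    have : (prob S fun x => ¬P x) * S.card ≤ β * S.card := by gcongr
    linarith
  have hle : ((S ∩ T.filter P).card : ℝ) ≤ (T.filter P).card := by
    exact_mod_cast Multiset.card_le_card Multiset.inter_le_right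
  have hsec : α' * (T.filter P).card ≤ (S ∩ T.filter P).card := by
    -- `1 - α / 6 ≥ 5 / 6`; this is the origin of the factor `6 / 5` in the hypothesis on `α'`.
    have h3 : (S.card : ℝ) ≤ 6 / 5 * (S ∩ T).card := by nlinarith
    have h4 : β * S.card ≤ β * (6 / 5 * (S ∩ T).card) := by gcongr
    rcases le_or_gt 0 (1 - 6 / 5 * β) with h | h
    · have : α * T.card * (1 - 6 / 5 * β) ≤ (S ∩ T).card * (1 - 6 / 5 * β) := by gcongr
      linarith
    · have : α * T.card * (1 - 6 / 5 * β) ≤ 0 :=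
        mul_nonpos_of_nonneg_of_nonpos (by positivity) h.le
      have : (0 : ℝ) ≤ (S ∩ T.filter P).card := by positivity
      linarith
  -- That the level stays at most one is a consequence: `S` cannot occupy more than all of the
  -- filtered multiset.
  have hα'1 : α' ≤ 1 := by
    have : α' * (T.filter P).card ≤ 1 * (T.filter P).card := by linarith
    exact le_of_mul_le_mul_right this hT'
  refine ⟨hα.trans_le hαα', hα'1, ⟨S, hS.mono hdk hα hαα' hα'1, max_le ?_ hsec⟩,
    fun x hx y hy => hdiam x (Multiset.mem_of_mem_filter hx) y (Multiset.mem_of_mem_filter hy)⟩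
  have : β * S.card ≤ (α' - α) / 6 * S.card := by gcongr
  linarith

end good

/-! ### Existence of a splitting threshold -/

section split

variable {d : ℕ} {T : Multiset (Fin d → ℝ)} {p : (Fin d → ℝ) → ℝ}

/-- `b` is the largest attained value whose upper tail has mass at least `q`; a strict tail of mass
`q` would make the next attained value a larger candidate. -/
lemma exists_upper_quantile (hT : T ≠ 0) (p : (Fin d → ℝ) → ℝ) {q : ℝ} (hq : 0 < q)
    (hq1 : q ≤ 1) :
    ∃ b, q ≤ (prob T fun x => b ≤ p x) ∧ (prob T fun x => b < p x) < q := by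
  classical
  obtain ⟨x₀, hx₀, hmin⟩ := T.toFinset.exists_min_image p (Multiset.toFinset_nonempty.2 hT)
  have hone : (prob T fun x => p x₀ ≤ p x) = 1 := by
    have h := prob_add_prob_not (P := fun x => p x₀ ≤ p x) hT
    rwa [prob_eq_zero (P := fun x => ¬ p x₀ ≤ p x) fun x hx h => h (hmin x (by simpa using hx)),
      add_zero] at h
  obtain ⟨x₁, hx₁, hmax⟩ := (T.toFinset.filter fun y => q ≤ prob T fun x => p y ≤ p x).exists_max_image
    p ⟨x₀, Finset.mem_filter.2 ⟨hx₀, by rw [hone]; exact hq1⟩⟩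
  refine ⟨p x₁, (Finset.mem_filter.1 hx₁).2, ?_⟩
  by_contra! hlt
  have hne : (T.toFinset.filter fun y => p x₁ < p y).Nonempty := by
    by_contra hn
    rw [Finset.not_nonempty_iff_eq_empty, Finset.filter_eq_empty_iff] at hn
    rw [prob_eq_zero fun x hx => hn (by simpa using hx)] at hlt
    linarith
  obtain ⟨x₂, hx₂, hmin₂⟩ := Finset.exists_min_image _ p hne
  rw [Finset.mem_filter] at hx₂
  have h2 : q ≤ prob T fun x => p x₂ ≤ p x := hlt.trans (prob_mono fun x hx h =>
    hmin₂ x (Finset.mem_filter.2 ⟨by simpa using hx, h⟩))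
  exact absurd hx₂.2 (not_lt.2 (hmax x₂ (Finset.mem_filter.2 ⟨hx₂.1, h2⟩)))

/-- If no threshold splits `T`, then the upper tail of `p` grows quickly. -/
lemma half_lt_prob_of_forall_not_split (hT : T ≠ 0) {R α a b : ℝ} (hR : 0 < R) (hα0 : 0 < α)
    (hno : ∀ t, α / 4 ≤ (prob T fun x => p x ≤ t - R) → α / 4 ≤ (prob T fun x => t + R ≤ p x) →
      (1 - α / 100) ^ 2 < (1 - prob T fun x => p x ≤ t - R) ^ 2 +
        (1 - prob T fun x => t + R ≤ p x) ^ 2)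
    (ha : α / 4 ≤ prob T fun x => p x ≤ a) (hb : α / 4 ≤ prob T fun x => b ≤ p x)
    {J : ℕ} (hJ : 2 * R * J ≤ b - a) (hJ2 : (5 / 14 : ℝ) ^ 2 ^ J < 5 / 28 * α) :
    1 / 2 < prob T fun x => b - 2 * R * J ≤ p x := by
  by_contra! hhalf
  set G : ℕ → ℝ := fun j => prob T fun x => b - 2 * R * j ≤ p x with hG
  have hGJ : ∀ j ≤ J, G j ≤ 1 / 2 := fun j hj => le_trans (prob_mono fun x _ hx => by
    have : 2 * R * (j : ℝ) ≤ 2 * R * J := by gcongr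
    linarith) hhalf
  -- The normalization `5 / 7` turns the recursion `7/5 * G j ≤ G (j + 1) ^ 2` into plain squaring.
  have key : ∀ j ≤ J, 5 / 28 * α ≤ (5 / 7 * G j) ^ 2 ^ j := by
    intro j
    induction j with
    | zero =>
      intro _
      simp only [hG, Nat.cast_zero, mul_zero, sub_zero, pow_zero, pow_one]
      linarith
    | succ j ih =>
      intro hj
      refine (ih (by omega)).trans ?_
      rw [pow_succ' 2 j, pow_mul]
      have hj' : 2 * R * ((j : ℝ) + 1) ≤ 2 * R * J := by
        gcongr
        exact_mod_cast hj
      have g1 : α / 4 ≤ G j := hb.trans (prob_mono fun x _ hx => by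
        have : 0 ≤ 2 * R * j := by positivity
        linarith)
      have f1 : α / 4 ≤ prob T fun x => p x ≤ b - 2 * R * j - R - R :=
        ha.trans (prob_mono fun x _ hx => by linarith)
      -- This threshold has `t + R = b - 2Rj` and `t - R = b - 2R(j + 1)`, so that its two tails are
      -- governed by `G j` and `G (j + 1)`.
      have h := hno (b - 2 * R * j - R) f1 (by rw [sub_add_cancel]; exact g1)
      have h1 : (1 - prob T fun x => p x ≤ b - 2 * R * j - R - R) ≤ G (j + 1) := by
        have h2 := prob_add_prob_not (P := fun x => p x ≤ b - 2 * R * j - R - R) hT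
        have h3 : (prob T fun x => ¬ p x ≤ b - 2 * R * j - R - R) ≤ G (j + 1) :=
          prob_mono fun x _ hx => by push_cast; linarith
        linarith
      have h2 : 0 ≤ (1 - prob T fun x => p x ≤ b - 2 * R * j - R - R) := by
        linarith [prob_le_one (T := T) (P := fun x => p x ≤ b - 2 * R * j - R - R)]
      have h3 := pow_le_pow_left₀ h2 h1 2
      simp only [sub_add_cancel] at h
      change _ < _ + (1 - G j) ^ 2 at h
      have h4 := hGJ j (by omega)
      have h5 : (1 - G j / 25) ^ 2 ≤ (1 - α / 100) ^ 2 := by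
        apply pow_le_pow_left₀ <;> linarith
      -- With `α / 100 ≤ G j / 25` the failed split gives `G (j + 1)² > (1 - G j / 25)² - (1 - G
      -- j)²`, and `G j ≤ 1 / 2` makes this at least `1.4 * G j`.
      have h6 : 7 / 5 * G j ≤ G (j + 1) ^ 2 := by nlinarith
      have : 0 ≤ G j := by linarith
      gcongr
      rw [mul_pow]
      linarith
  have h1 := key J le_rfl
  have h2 : (5 / 7 * G J) ^ 2 ^ J ≤ (5 / 14 : ℝ) ^ 2 ^ J := by
    have : 0 ≤ G J := prob_nonneg
    have := hGJ J le_rfl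
    gcongr
    linarith
  linarith

lemma log_two_le_log_two_add {α : ℝ} (hα0 : 0 < α) (hα1 : α < 1) :
    69 / 100 ≤ Real.log (2 + Real.log (1 / α)) := by
  have h1 : 0 < Real.log (1 / α) := Real.log_pos (by rw [lt_div_iff₀ hα0]; linarith)
  have h2 : Real.log 2 ≤ Real.log (2 + Real.log (1 / α)) := by
    apply Real.log_le_log <;> linarith
  have := Real.log_two_gt_d9
  norm_num at this
  linarith

/-- `J = ⌈log₂(2 + log(1/α))⌉` works: `5/14 ≤ e⁻¹`, so the doubly exponential power is at most `e⁻²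
α`. -/
lemma exists_steps {α : ℝ} (hα0 : 0 < α) (hα1 : α < 1) :
    ∃ J : ℕ, (J : ℝ) ≤ 3 * Real.log (2 + Real.log (1 / α)) ∧
      (5 / 14 : ℝ) ^ 2 ^ J < 5 / 28 * α := by
  have h1 : 0 < Real.log (1 / α) := Real.log_pos (by rw [lt_div_iff₀ hα0]; linarith)
  set y := 2 + Real.log (1 / α) with hy
  have hl : 69 / 100 ≤ Real.log y := log_two_le_log_two_add hα0 hα1
  have l2 := Real.log_two_gt_d9
  norm_num at l2 hl
  have l2pos : 0 < Real.log 2 := by linarith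
  refine ⟨⌈Real.log y / Real.log 2⌉₊, ?_, ?_⟩
  · have h2 := (Nat.ceil_lt_add_one (a := Real.log y / Real.log 2) (by positivity)).le
    have h3 : Real.log y / Real.log 2 ≤ Real.log y / (69 / 100) := by gcongr; linarith
    norm_num at h3
    linarith
  · have h2 := Nat.le_ceil (Real.log y / Real.log 2)
    set J := ⌈Real.log y / Real.log 2⌉₊
    have h3 : y ≤ 2 ^ J := by
      rw [div_le_iff₀ l2pos, ← Real.log_pow] at h2
      exact (Real.log_le_log_iff (by linarith) (by positivity)).1 h2
    have h4 : (5 / 14 : ℝ) ≤ Real.exp (-1) := by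
      rw [Real.exp_neg]
      have := Real.exp_one_lt_d9
      rw [show (5 / 14 : ℝ) = (14 / 5)⁻¹ by norm_num]
      gcongr
      norm_num at this
      linarith
    calc (5 / 14 : ℝ) ^ 2 ^ J ≤ Real.exp (-1) ^ 2 ^ J := by gcongr
      _ = Real.exp (-2 ^ J) := by rw [← Real.exp_nat_mul]; push_cast; ring_nf
      _ ≤ Real.exp (-y) := by gcongr
      _ = Real.exp (-2) * α := by
          rw [hy, neg_add, Real.exp_add, one_div, Real.log_inv, neg_neg, Real.exp_log hα0]
      _ < 5 / 28 * α := by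
          have : Real.exp (-2) < 5 / 28 := by
            rw [Real.exp_neg, ← one_div, show (5 / 28 : ℝ) = 1 / (28 / 5) by norm_num]
            have := Real.exp_one_gt_d9
            have e : Real.exp 2 = Real.exp 1 * Real.exp 1 := by rw [← Real.exp_add]; norm_num
            rw [e]
            norm_num at this
            apply one_div_lt_one_div_of_lt (by norm_num)
            nlinarith
          gcongr

lemma Params.R_pos {P : Params} (hα0 : 0 < P.α) (hα1 : P.α < 1) (hC : 0 < P.C) : 0 < P.R := by
  have : 0 < Real.log (1 / P.α) := Real.log_pos (by rw [lt_div_iff₀ hα0]; linarith)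
  unfold Params.R
  positivity

lemma exists_isSplitThreshold {P : Params} (hα0 : 0 < P.α) (hα1 : P.α < 1) (hC : 12 ≤ P.C)
    (hT : T ≠ 0) (h : ¬ ∃ a, IsHeavy P T p a) : ∃ t, IsSplitThreshold P T p t := by
  classical
  by_contra! hns
  have hR : 0 < P.R := Params.R_pos hα0 hα1 (by linarith)
  have hTc := card_pos_of_ne_zero hT
  have hno : ∀ t, P.α / 4 ≤ (prob T fun x => p x ≤ t - P.R) →
      P.α / 4 ≤ (prob T fun x => t + P.R ≤ p x) →
      (1 - P.α / 100) ^ 2 < (1 - prob T fun x => p x ≤ t - P.R) ^ 2 +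
        (1 - prob T fun x => t + P.R ≤ p x) ^ 2 := by
    intro t h1 h2
    by_contra! h3
    refine hns t ?_
    have e1 : ((upper P T p t).card : ℝ) = (1 - prob T fun x => p x ≤ t - P.R) * T.card := by
      rw [upper, card_filter_eq hT, ← prob_add_prob_not (P := fun x => p x ≤ t - P.R) hT]
      simp
    have e2 : ((lower P T p t).card : ℝ) = (1 - prob T fun x => t + P.R ≤ p x) * T.card := by
      rw [lower, card_filter_eq hT, ← prob_add_prob_not (P := fun x => t + P.R ≤ p x) hT]
      simp
    rw [IsSplitThreshold, e1, e2]
    constructor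
    · have := mul_le_mul_of_nonneg_left h3 (sq_nonneg (T.card : ℝ))
      linarith
    · rw [← max_mul_of_nonneg _ _ hTc.le]
      have h4 : max (1 - prob T fun x => p x ≤ t - P.R) (1 - prob T fun x => t + P.R ≤ p x) ≤
        1 - P.α / 4 := max_le (by linarith) (by linarith)
      have := mul_le_mul_of_nonneg_right h4 hTc.le
      linarith
  obtain ⟨b, hb, hb'⟩ := exists_upper_quantile hT p (q := P.α / 4) (by linarith) (by linarith)
  obtain ⟨a', ha, ha'⟩ := exists_upper_quantile hT (fun x => -p x) (q := P.α / 4) (by linarith)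
    (by linarith)
  obtain ⟨a, rfl⟩ : ∃ a, a' = -a := ⟨-a', by simp⟩
  simp only [neg_le_neg_iff, neg_lt_neg_iff] at ha ha'
  -- Otherwise the interval from `a` of length `L` would miss at most `α / 4` of the mass on each
  -- side and be heavy.
  have hab : P.L < b - a := by
    by_contra! hle
    refine h ⟨a, ?_⟩
    unfold IsHeavy
    have h1 := prob_add_prob_not (P := fun x => p x ∈ Set.Icc a (a + P.L)) hT
    have h2 : (prob T fun x => ¬ p x ∈ Set.Icc a (a + P.L)) ≤
        (prob T fun x => p x < a) + prob T fun x => b < p x := by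
      refine (prob_mono fun x _ hx => ?_).trans prob_or_le
      by_contra! hx'
      exact hx ⟨hx'.1, by linarith [hx'.2]⟩
    linarith
  obtain ⟨J, hJ1, hJ2⟩ := exists_steps hα0 hα1
  have hJL : 4 * P.R * J ≤ P.L := by
    have hl := log_two_le_log_two_add hα0 hα1
    have hl0 : 0 ≤ Real.log (2 + Real.log (1 / P.α)) := by norm_num at hl; linarith
    calc 4 * P.R * J ≤ 4 * P.R * (3 * Real.log (2 + Real.log (1 / P.α))) := by gcongr
      _ = 12 * P.R * Real.log (2 + Real.log (1 / P.α)) := by ring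
      _ ≤ _ := by unfold Params.L; gcongr
  have hRJ : 0 ≤ P.R * J := by positivity
  have u1 := half_lt_prob_of_forall_not_split hT hR hα0 hno ha hb (J := J) (by linarith) hJ2
  -- Negating `p` exchanges the two tails.
  have u2 := half_lt_prob_of_forall_not_split (p := fun x => -p x) (a := -b) (b := -a) hT hR hα0
    (fun t h1 h2 => by
      have e1 : (fun x => -p x ≤ t - P.R) = fun x => -t + P.R ≤ p x := by
        ext x; constructor <;> intro h <;> linarith
      have e2 : (fun x => t + P.R ≤ -p x) = fun x => p x ≤ -t - P.R := by
        ext x; constructor <;> intro h <;> linarith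
      rw [e1] at h1 ⊢
      rw [e2] at h2 ⊢
      rw [add_comm]
      exact hno (-t) h2 h1) (by simpa using hb) (by simpa using ha) (J := J) (by linarith) hJ2
  -- Two events of probability above `1 / 2` meet, which would force `b - a ≤ 4RJ ≤ L`.
  obtain ⟨x, _, h1, h2⟩ := exists_mem_and_of_one_lt (T := T)
    (P := fun x => b - 2 * P.R * J ≤ p x) (Q := fun x => -a - 2 * P.R * J ≤ -p x) (by linarith)
  linarith

end split

/-! ### Existence of a filtering threshold -/

section mean

variable {d : ℕ} {T : Multiset (Fin d → ℝ)} {f g : (Fin d → ℝ) → ℝ}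

lemma mean_le_mean (h : ∀ x ∈ T, f x ≤ g x) : mean T f ≤ mean T g := by
  unfold mean
  gcongr
  exact Multiset.sum_map_le_sum_map _ _ h

lemma mean_add : mean T (fun x => f x + g x) = mean T f + mean T g := by
  simp only [mean, Multiset.sum_map_add, add_div]

lemma mean_const_mul (c : ℝ) : mean T (fun x => c * f x) = c * mean T f := by
  simp only [mean, Multiset.sum_map_mul_left, mul_div_assoc]

lemma mean_const (hT : T ≠ 0) (c : ℝ) : mean T (fun _ => c) = c := by
  have := card_pos_of_ne_zero hT
  simp only [mean, Multiset.map_const', Multiset.sum_replicate, nsmul_eq_mul]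
  field_simp

lemma var_le_mean_sub_sq (hT : T ≠ 0) (p : (Fin d → ℝ) → ℝ) (c : ℝ) :
    var T p ≤ mean T fun x => (p x - c) ^ 2 := by
  have e : (fun x => (p x - c) ^ 2) = fun x => (p x - mean T p) ^ 2 +
      (2 * (mean T p - c) * p x + (c ^ 2 - mean T p ^ 2)) := by
    ext x; ring
  rw [e, mean_add, mean_add, mean_const_mul, mean_const hT, var]
  nlinarith [sq_nonneg (mean T p - c)]

open scoped Classical in
lemma mean_sum_indicator {ι : Type*} (s : Finset ι) (c : ι → ℝ) (P : ι → (Fin d → ℝ) → Prop) :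
    (mean T fun x => ∑ j ∈ s, c j * if P j x then 1 else 0) = ∑ j ∈ s, c j * prob T (P j) := by
  induction s using Finset.induction_on with
  | empty => simp [mean]
  | insert j s hj ih =>
    simp only [Finset.sum_insert hj]
    rw [mean_add, mean_const_mul, ih]
    congr 2
    unfold mean prob
    congr 1
    clear ih
    induction T using Multiset.induction_on with
    | empty => simp
    | cons a t ih => by_cases h : P j a <;> simp [h, ih, add_comm]

lemma sum_range_odd_mul_half_pow (n : ℕ) :
    ∑ j ∈ Finset.range n, (2 * (j : ℝ) + 1) * (1 / 2) ^ j = 6 - (4 * n + 6) * (1 / 2) ^ n := by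
  induction n with
  | zero => norm_num
  | succ n ih =>
    rw [Finset.sum_range_succ, ih]
    push_cast
    ring

lemma sum_range_odd (n : ℕ) : ∑ j ∈ Finset.range n, (2 * (j : ℝ) + 1) = (n : ℝ) ^ 2 := by
  induction n with
  | zero => norm_num
  | succ n ih =>
    rw [Finset.sum_range_succ, ih]
    push_cast
    ring

/-- Layer-cake summation, based on `(n + 1)² = ∑_{j ≤ n} (2j + 1)`. -/
lemma mean_sq_le_of_prob_le {N : ℕ} {f : (Fin d → ℝ) → ℕ} {η : ℝ} (hη : 0 ≤ η)
    (hf : ∀ x ∈ T, f x ≤ N)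
    (hp : ∀ j, 1 ≤ j → (prob T fun x => j ≤ f x) ≤ 2 * (1 / 2) ^ j + η) :
    (mean T fun x => ((f x : ℝ) + 1) ^ 2) ≤ 12 + ((N : ℝ) + 1) ^ 2 * η := by
  classical
  have e : ∀ x ∈ T, ((f x : ℝ) + 1) ^ 2 ≤
      ∑ j ∈ Finset.range (N + 1), (2 * (j : ℝ) + 1) * if j ≤ f x then 1 else 0 := by
    intro x hx
    have h1 := hf x hx
    have : Finset.range (f x + 1) = (Finset.range (N + 1)).filter fun j => j ≤ f x := by
      ext j
      simp only [Finset.mem_range, Finset.mem_filter]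
      omega
    simp only [mul_ite, mul_one, mul_zero]
    rw [← Finset.sum_filter, ← this, sum_range_odd]
    push_cast
    rfl
  refine (mean_le_mean e).trans ?_
  have := mean_sum_indicator (T := T) (Finset.range (N + 1)) (fun j => 2 * (j : ℝ) + 1)
    (fun j x => j ≤ f x)
  refine le_trans (le_of_eq ?_) (this.le.trans ?_)
  · congr!
  calc _ ≤ ∑ j ∈ Finset.range (N + 1), (2 * (j : ℝ) + 1) * (2 * (1 / 2) ^ j + η) := by
        refine Finset.sum_le_sum fun j _ => ?_
        gcongr
        rcases Nat.eq_zero_or_pos j with rfl | hj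
        · refine prob_le_one.trans ?_
          norm_num
          linarith
        · exact hp j hj
    _ = 2 * ∑ j ∈ Finset.range (N + 1), (2 * (j : ℝ) + 1) * (1 / 2) ^ j +
        (∑ j ∈ Finset.range (N + 1), (2 * (j : ℝ) + 1)) * η := by
        rw [Finset.mul_sum, Finset.sum_mul, ← Finset.sum_add_distrib]
        exact Finset.sum_congr rfl fun j _ => by ring
    _ ≤ _ := by
        rw [sum_range_odd, sum_range_odd_mul_half_pow]
        push_cast
        have : 0 ≤ (4 * ((N : ℝ) + 1) + 6) * (1 / 2) ^ (N + 1) := by positivity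
        linarith

end mean

/-! ### Powers with exponents `l / 2` and `2 / l`, and integration of the tails -/

lemma rpow_two_div_rpow_div_two {l : ℕ} (hl : l = 1 ∨ l = 2) {x : ℝ} (hx : 0 ≤ x) :
    (x ^ ((l : ℝ) / 2)) ^ (2 / (l : ℝ)) = x := by
  have : (l : ℝ) ≠ 0 := by rcases hl with rfl | rfl <;> norm_num
  rw [← Real.rpow_mul hx]
  field_simp
  simp

lemma rpow_two_div_pow {l : ℕ} (hl : l = 1 ∨ l = 2) {x : ℝ} (hx : 0 ≤ x) :
    (x ^ (2 / (l : ℝ))) ^ l = x ^ 2 := by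
  have : (l : ℝ) ≠ 0 := by rcases hl with rfl | rfl <;> norm_num
  rw [← Real.rpow_natCast, ← Real.rpow_mul hx]
  field_simp
  norm_cast

lemma rpow_div_two_sq {l : ℕ} {x : ℝ} (hx : 0 ≤ x) : (x ^ ((l : ℝ) / 2)) ^ 2 = x ^ l := by
  rw [← Real.rpow_natCast, ← Real.rpow_mul hx, ← Real.rpow_natCast]
  norm_num

lemma distInterval_le_abs_sub {a b y z : ℝ} (hz : z ∈ Set.Icc a b) :
    distInterval a b y ≤ |y - z| := by
  obtain ⟨h1, h2⟩ := hz
  refine max_le (abs_nonneg _) (max_le ?_ ?_)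
  · linarith [neg_abs_le (y - z)]
  · linarith [le_abs_self (y - z)]

lemma IsHeavy.exists_mem {d : ℕ} {P : Params} {T : Multiset (Fin d → ℝ)} {p : (Fin d → ℝ) → ℝ}
    {a : ℝ} (hα1 : P.α < 1) (h : IsHeavy P T p a) :
    ∃ x ∈ T, p x ∈ Set.Icc a (a + P.L) := by
  by_contra! hn
  unfold IsHeavy at h
  rw [prob_eq_zero hn] at h
  linarith

lemma exists_isFilterThreshold {d : ℕ} {P : Params} {T : Multiset (Fin d → ℝ)}
    {p : (Fin d → ℝ) → ℝ} {a : ℝ} (hl : P.l = 1 ∨ P.l = 2) (hα0 : 0 < P.α) (hα1 : P.α < 1)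
    (hC : 12 ≤ P.C) (hdk : Real.exp 2 ≤ (d : ℝ) * (P.k : ℝ) * Real.log (1 / P.τ)) (hT : T ≠ 0)
    (hdiam : ¬ DiameterTest P T p) (ha : IsHeavy P T p a)
    (hvar : P.L ^ 2 + 16 * P.R ^ 2 + 40 * (P.C * Real.log (32 / P.α)) ^ P.l < var T p) :
    ∃ t, IsFilterThreshold P T p a t := by
  by_contra! hno
  refine absurd hvar (not_lt.2 ?_)
  have hR := Params.R_pos hα0 hα1 (by linarith)
  have hC0 : 0 < P.C := by linarith
  set γ := logFactor d P.k P.α P.τ with hγ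
  have hγ2 : 2 ≤ γ := (logFactor_antitone hdk hα0 le_rfl hα1.le).1
  have hk1 : (1 : ℝ) ≤ (P.k : ℝ) ^ 2 := by
    exact_mod_cast Nat.one_le_pow _ _ (one_le_of_exp_two_le hdk)
  have hkγ : 2 ≤ (P.k : ℝ) ^ 2 * γ := by nlinarith
  set A := 32 / P.α with hA
  have hA32 : 32 ≤ A := by rw [hA, le_div_iff₀ hα0]; linarith
  have hlogA : 1 ≤ Real.log A := by
    rw [Real.le_log_iff_exp_le (by linarith)]
    linarith [Real.exp_one_lt_d9]
  -- Raising `s^{2/l}` by one unit `M` divides `exp(-s^{2/l}/C)` by `A = 32 / α`, so the prefactor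
  -- `A` costs a single unit.
  set M := P.C * Real.log A with hM
  have hM0 : 0 < M := by positivity
  have hCM : P.C ≤ M := by nlinarith
  set η := 2 * P.α ^ 2 / ((P.k : ℝ) ^ 2 * γ) ^ 2 with hη
  set D : (Fin d → ℝ) → ℝ := fun x => distInterval a (a + P.L) (p x) with hD
  set w : (Fin d → ℝ) → ℝ := fun x => max 0 (D x - 2 * P.R) with hw
  have hw0 : ∀ x, 0 ≤ w x := fun x => le_max_left _ _
  have hlpos : (0 : ℝ) < P.l := by rcases hl with h | h <;> rw [h] <;> norm_num
  set f : (Fin d → ℝ) → ℕ := fun x => ⌊w x ^ (2 / (P.l : ℝ)) / M⌋₊ with hf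
  obtain ⟨y, hyT, hy⟩ := ha.exists_mem hα1
  -- The failed diameter test bounds the range of `p` on `T`, and `y` anchors it in the interval.
  have hfN : ∀ x ∈ T, f x ≤ ⌊1 + (P.k : ℝ) ^ 2 * γ⌋₊ := by
    intro x hx
    apply Nat.floor_le_floor
    rw [div_le_iff₀ hM0]
    have h1 : w x ≤ (P.C * (1 + (P.k : ℝ) ^ 2 * γ / P.l)) ^ ((P.l : ℝ) / 2) := by
      refine max_le (by positivity) ?_
      have h2 : D x ≤ |p x - p y| := distInterval_le_abs_sub hy
      have h3 := not_exists.1 hdiam x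
      push Not at h3
      have := h3 hx y hyT
      linarith
    calc w x ^ (2 / (P.l : ℝ))
        ≤ ((P.C * (1 + (P.k : ℝ) ^ 2 * γ / P.l)) ^ ((P.l : ℝ) / 2)) ^ (2 / (P.l : ℝ)) := by
          have := hw0 x
          gcongr
      _ = P.C * (1 + (P.k : ℝ) ^ 2 * γ / P.l) := rpow_two_div_rpow_div_two hl (by positivity)
      _ ≤ P.C * (1 + (P.k : ℝ) ^ 2 * γ) := by
          gcongr
          apply div_le_self (by positivity)
          rcases hl with h | h <;> rw [h] <;> norm_num
      _ ≤ (1 + (P.k : ℝ) ^ 2 * γ) * M := by rw [mul_comm]; gcongr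
  have hprob : ∀ j, 1 ≤ j → (prob T fun x => j ≤ f x) ≤ 2 * (1 / 2) ^ j + η := by
    intro j hj
    have hj0 : (0 : ℝ) < j := by exact_mod_cast hj
    set s := ((j : ℝ) * M) ^ ((P.l : ℝ) / 2) with hs
    have hs0 : 0 < s := by positivity
    have h1 : (prob T fun x => j ≤ f x) ≤ prob T fun x => 2 * P.R + s ≤ D x := by
      refine prob_mono fun x _ hx => ?_
      have h2 : (j : ℝ) ≤ w x ^ (2 / (P.l : ℝ)) / M :=
        (Nat.le_floor_iff' (by omega)).1 hx
      rw [le_div_iff₀ hM0] at h2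
      have h3 : s ≤ w x := by
        refine (Real.rpow_le_rpow_iff (z := 2 / (P.l : ℝ)) hs0.le (hw0 x) (by positivity)).1 ?_
        rw [hs, rpow_two_div_rpow_div_two hl (by positivity)]
        exact h2
      rcases le_max_iff.1 h3 with h | h
      · linarith
      · linarith
    have h2 := hno (2 * P.R + s)
    unfold IsFilterThreshold at h2
    push Not at h2
    have h3 := h2 (by linarith)
    rw [add_sub_cancel_left, hs, rpow_two_div_rpow_div_two hl (by positivity)] at h3
    refine h1.trans (h3.trans (add_le_add ?_ le_rfl))
    have h4 : Real.exp (-((j : ℝ) * M / P.C)) = A⁻¹ ^ j := by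
      have : -((j : ℝ) * M / P.C) = j * -Real.log A := by rw [hM]; field_simp
      rw [this, Real.exp_nat_mul, Real.exp_neg, Real.exp_log (by linarith)]
    rw [h4]
    obtain ⟨i, rfl⟩ := Nat.exists_eq_add_of_le' hj
    have hAi : A⁻¹ ≤ 1 / 2 := by
      rw [one_div]; apply inv_anti₀ <;> linarith
    have hA0 : A ≠ 0 := by positivity
    rw [pow_succ', pow_succ', ← mul_assoc, mul_inv_cancel₀ hA0, one_mul]
    calc A⁻¹ ^ i ≤ (1 / 2) ^ i := by gcongr
      _ = _ := by ring
  have hmean := mean_sq_le_of_prob_le (by positivity) hfN hprob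
  -- The factor `(k²γ)²` in the denominator of `η` is made to cancel the square of the range of `f`.
  have hNη : (((⌊1 + (P.k : ℝ) ^ 2 * γ⌋₊ : ℕ) : ℝ) + 1) ^ 2 * η ≤ 8 := by
    have h1 := Nat.floor_le (show 0 ≤ 1 + (P.k : ℝ) ^ 2 * γ by positivity)
    calc _ ≤ (2 * ((P.k : ℝ) ^ 2 * γ)) ^ 2 * η := by gcongr; linarith
      _ = 8 * P.α ^ 2 := by
          have hX : (P.k : ℝ) ^ 2 * γ ≠ 0 := by positivity
          rw [hη]
          generalize (P.k : ℝ) ^ 2 * γ = X at hX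
          field_simp
          norm_num
      _ ≤ 8 * 1 := by gcongr; exact pow_le_one₀ hα0.le hα1.le
      _ = 8 := by norm_num
  have hL0 : 0 ≤ P.L := by linarith [hy.1, hy.2]
  refine (var_le_mean_sub_sq hT p (a + P.L / 2)).trans ?_
  have hpt : ∀ x ∈ T, (p x - (a + P.L / 2)) ^ 2 ≤
      (P.L ^ 2 + 16 * P.R ^ 2) + 2 * M ^ P.l * ((f x : ℝ) + 1) ^ 2 := by
    intro x _
    have h1 : |p x - (a + P.L / 2)| ≤ P.L / 2 + 2 * P.R + w x := by
      have h2 : D x ≤ 2 * P.R + w x := by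
        linarith [le_max_right 0 (D x - 2 * P.R)]
      have h3 : a - p x ≤ D x := (le_max_left _ _).trans (le_max_right _ _)
      have h4 : p x - (a + P.L) ≤ D x := (le_max_right _ _).trans (le_max_right _ _)
      rw [abs_le]
      constructor <;> linarith
    have h2 : w x ^ 2 ≤ M ^ P.l * ((f x : ℝ) + 1) ^ 2 := by
      have h3 : w x ^ (2 / (P.l : ℝ)) ≤ M * ((f x : ℝ) + 1) := by
        have := Nat.lt_floor_add_one (w x ^ (2 / (P.l : ℝ)) / M)
        rw [div_lt_iff₀ hM0] at this
        rw [mul_comm]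
        exact this.le
      rw [← rpow_two_div_pow hl (hw0 x)]
      calc _ ≤ (M * ((f x : ℝ) + 1)) ^ P.l := by
            have := hw0 x
            gcongr
        _ = M ^ P.l * ((f x : ℝ) + 1) ^ P.l := mul_pow _ _ _
        _ ≤ _ := by
          gcongr
          · have : (0 : ℝ) ≤ f x := by positivity
            linarith
          · rcases hl with h | h <;> omega
    have h3 := pow_le_pow_left₀ (abs_nonneg _) h1 2
    rw [sq_abs] at h3
    nlinarith [sq_nonneg (P.L / 2 + 2 * P.R - w x), sq_nonneg (P.L / 2 - 2 * P.R)]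
  refine (mean_le_mean hpt).trans ?_
  rw [mean_add, mean_const hT, mean_const_mul]
  have : 2 * M ^ P.l * (mean T fun x => ((f x : ℝ) + 1) ^ 2) ≤ 2 * M ^ P.l * 20 := by
    gcongr
    linarith
  linarith

lemma Params.R_sq_le {P : Params} (hl : P.l = 1 ∨ P.l = 2) (hα0 : 0 < P.α) (hα1 : P.α < 1)
    (hC : 1 ≤ P.C) : P.R ^ 2 ≤ P.C ^ 2 * Real.log (1 / P.α) ^ P.l := by
  have : 0 < Real.log (1 / P.α) := Real.log_pos (by rw [lt_div_iff₀ hα0]; linarith)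
  rw [Params.R, rpow_div_two_sq (by positivity), mul_pow]
  gcongr
  rcases hl with h | h <;> omega

/-- Constants are absorbed by means of `log 32 ≤ 4 ≤ (4 / lam) log(1/α)` and `3 log²(2 + log(1/α)) ≥
1`. -/
lemma variance_bound {P : Params} (hl : P.l = 1 ∨ P.l = 2) (hα0 : 0 < P.α) (hα1 : P.α < 1)
    (hC : 12 ≤ P.C) {lam : ℝ} (hlam : 0 < lam) (hle : lam ≤ Real.log (1 / P.α)) :
    P.L ^ 2 + 16 * P.R ^ 2 + 40 * (P.C * Real.log (32 / P.α)) ^ P.l ≤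
      (P.C ^ 4 + 48 * P.C ^ 2 + 120 * (P.C * (1 + 4 / lam)) ^ 2) *
        Real.log (1 / P.α) ^ P.l * Real.log (2 + Real.log (1 / P.α)) ^ 2 := by
  have hg := log_two_le_log_two_add hα0 hα1
  have hR := Params.R_sq_le hl hα0 hα1 (by linarith)
  set g := Real.log (2 + Real.log (1 / P.α))
  set ell := Real.log (1 / P.α) with hell
  have hell0 : 0 < ell := by linarith
  have hg2 : 1 ≤ 3 * g ^ 2 := by nlinarith
  have hM : (P.C * Real.log (32 / P.α)) ^ P.l ≤ (P.C * (1 + 4 / lam)) ^ 2 * ell ^ P.l := by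
    have h1 : Real.log (32 / P.α) ≤ (1 + 4 / lam) * ell := by
      have h2 : Real.log (32 / P.α) = Real.log 32 + ell := by
        rw [hell, ← Real.log_mul (by norm_num) (by positivity)]
        congr 1; ring
      have h3 : Real.log 32 ≤ 4 := by
        rw [show (32 : ℝ) = 2 ^ 5 by norm_num, Real.log_pow]
        push_cast
        linarith [Real.log_two_lt_d9]
      have h4 : 4 ≤ 4 / lam * ell := by
        rw [div_mul_eq_mul_div, le_div_iff₀ hlam]
        linarith
      linarith
    have h0 : 0 ≤ Real.log (32 / P.α) := Real.log_nonneg (by rw [le_div_iff₀ hα0]; linarith)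
    calc _ ≤ (P.C * ((1 + 4 / lam) * ell)) ^ P.l := by
          have : 0 ≤ P.C := by linarith
          gcongr
      _ = (P.C * (1 + 4 / lam)) ^ P.l * ell ^ P.l := by rw [← mul_assoc, mul_pow]
      _ ≤ _ := by
          gcongr
          · have : 0 ≤ 4 / lam := by positivity
            nlinarith
          · rcases hl with h | h <;> omega
  have hL : P.L ^ 2 ≤ P.C ^ 4 * ell ^ P.l * g ^ 2 := by
    have : P.L ^ 2 = P.C ^ 2 * P.R ^ 2 * g ^ 2 := by unfold Params.L; ring
    rw [this]
    calc _ ≤ P.C ^ 2 * (P.C ^ 2 * ell ^ P.l) * g ^ 2 := by gcongr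
      _ = _ := by ring
  have h2 : 16 * P.R ^ 2 ≤ 48 * P.C ^ 2 * ell ^ P.l * g ^ 2 := by
    calc _ ≤ 16 * (P.C ^ 2 * ell ^ P.l) * 1 := by linarith
      _ ≤ 16 * (P.C ^ 2 * ell ^ P.l) * (3 * g ^ 2) := by gcongr
      _ = _ := by ring
  have h3 : 40 * (P.C * Real.log (32 / P.α)) ^ P.l ≤
      120 * (P.C * (1 + 4 / lam)) ^ 2 * ell ^ P.l * g ^ 2 := by
    calc _ ≤ 40 * ((P.C * (1 + 4 / lam)) ^ 2 * ell ^ P.l) * 1 := by linarith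
      _ ≤ 40 * ((P.C * (1 + 4 / lam)) ^ 2 * ell ^ P.l) * (3 * g ^ 2) := by gcongr
      _ = _ := by ring
  linarith

/-! ### Correctness of the outputs -/

section correct

variable {d : ℕ} {P : Params} {T : Multiset (Fin d → ℝ)} {p : (Fin d → ℝ) → ℝ} {μ : Fin d → ℝ}
  {ρ : ℝ}

open scoped Classical in
-- Without such a point, `|S ∩ T| ≤ |S|/4 + α|T|/2`. Since `|S| ≤ (6/5)|S ∩ T|` and `α|T| ≤ |S ∩
-- T|`, the right side is at most `(4/5)|S ∩ T|`.
lemma exists_mem_inter {S : Multiset (Fin d → ℝ)} {α : ℝ} {Q Q' : (Fin d → ℝ) → Prop}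
    (hα : 0 < α) (hα1 : α ≤ 1) (hT : T ≠ 0)
    (hST : max ((1 - α / 6) * (S.card : ℝ)) (α * (T.card : ℝ)) ≤ ((S ∩ T).card : ℝ))
    (hQ : (prob S fun x => ¬Q x) ≤ 1 / 4) (hQ' : 1 - α / 2 ≤ prob T Q') :
    ∃ x ∈ T, Q x ∧ Q' x := by
  obtain ⟨hS1, hS2⟩ := max_le_iff.1 hST
  have hTc := card_pos_of_ne_zero hT
  have hpos : 0 < α * T.card := by positivity
  have hSne : S ≠ 0 := by
    rintro rfl
    simp at hS2
    linarith
  by_contra! hn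
  have e1 : ((S ∩ T).card : ℝ) =
      ((S ∩ T).filter fun x => ¬Q x).card + ((S ∩ T).filter fun x => ¬¬Q x).card := by
    rw [← Nat.cast_add, ← Multiset.card_add, Multiset.filter_add_not]
  have e2 : (((S ∩ T).filter fun x => ¬Q x).card : ℝ) ≤ (S.filter fun x => ¬Q x).card := by
    exact_mod_cast Multiset.card_le_card (Multiset.filter_le_filter _ Multiset.inter_le_left)
  have e3 : (((S ∩ T).filter fun x => ¬¬Q x).card : ℝ) ≤ (T.filter fun x => ¬Q' x).card := by
    refine Nat.cast_le.2 (Multiset.card_le_card (Multiset.le_filter.2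
      ⟨(Multiset.filter_le _ _).trans Multiset.inter_le_right, fun x hx => ?_⟩))
    rw [Multiset.mem_filter, not_not] at hx
    exact hn x (Multiset.mem_of_le Multiset.inter_le_right hx.1) hx.2
  rw [card_filter_eq hSne] at e2
  rw [card_filter_eq hT] at e3
  have hS0 : (0 : ℝ) ≤ S.card := by positivity
  have h1 := mul_le_mul_of_nonneg_right hQ hS0
  have h2 : (prob T fun x => ¬Q' x) ≤ α / 2 := by
    linarith [prob_add_prob_not (P := Q') hT]
  have h3 := mul_le_mul_of_nonneg_right h2 hTc.le
  nlinarith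

/-- Each coordinate is a sparse linear form of variance one, so some point of `T` is within `16` of
`μ` in that coordinate; the `ℓ_∞` diameter bound extends this to all of `T`. -/
lemma not_diameterTest {c : ℝ} (hc : 0 < c) (hα0 : 0 < P.α) (hC : 36 * (16 + c) ^ 2 ≤ P.C)
    (hdk : Real.exp 2 ≤ (d : ℝ) * (P.k : ℝ) * Real.log (1 / P.τ))
    (hρ : ρ ≤ c * √(logFactor d P.k P.α P.τ)) (hp : IsSparsePoly P.k P.l p)
    (hvar : variance p (gaussianLaw μ) ≤ 1) (hT : T ≠ 0) (hgood : IsGood P.k P.τ ρ μ P.α T) :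
    ¬ DiameterTest P T p := by
  obtain ⟨-, hα1, ⟨S, hS, hST⟩, hdiam⟩ := hgood
  have hk := one_le_of_exp_two_le hdk
  have hk1 : (1 : ℝ) ≤ P.k := by exact_mod_cast hk
  set γ := logFactor d P.k P.α P.τ with hγ
  have hγ2 : 2 ≤ γ := (logFactor_antitone hdk hα0 le_rfl hα1).1
  have hsq : 1 ≤ √γ := Real.one_le_sqrt.2 (by linarith)
  have hr : 1 ≤ (16 + c) * √γ := by nlinarith
  have hnorm : ∀ x ∈ T, ‖x - μ‖ ≤ (16 + c) * √γ := by
    intro x hx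
    refine (pi_norm_le_iff_of_nonneg (by linarith)).2 fun i => ?_
    obtain ⟨h1, h2⟩ := gaussianLaw_eval μ i
    have h3 := hS.prob_abs_ge_sixteen_le (isSparsePoly_eval hk i) h2.le hdk hα0 hα1
    rw [h1] at h3
    obtain ⟨z, hzT, hz, -⟩ := exists_mem_inter (Q := fun x => ¬ 16 ≤ |x i - μ i|)
      (Q' := fun _ => True) hα0 hα1 hT hST (by simpa only [not_not] using h3) (by
        have := prob_add_prob_not (P := fun _ => True) hT
        rw [prob_eq_zero (P := fun _ => ¬True) (by simp)] at this
        linarith)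
    have h4 : |x i - z i| ≤ ρ := (norm_le_pi_norm (x - z) i).trans (hdiam x hx z hzT)
    rw [Pi.sub_apply, Real.norm_eq_abs]
    have h5 := abs_sub_le (x i) (z i) (μ i)
    push Not at hz
    nlinarith
  rintro ⟨x, hx, y, hy, hxy⟩
  refine absurd hxy (not_le.2 ?_)
  have hx' := hp.abs_sub_integral_le hvar hr (hnorm x hx)
  have hy' := hp.abs_sub_integral_le hvar hr (hnorm y hy)
  have h6 : |p x - p y| ≤ 6 * P.k * ((16 + c) * √γ) ^ P.l := by
    rw [abs_sub_comm] at hy'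
    have := abs_sub_le (p x) (∫ y, p y ∂gaussianLaw μ) (p y)
    linarith
  refine h6.trans_lt ?_
  have hC0 : 0 < P.C := lt_of_lt_of_le (by positivity) hC
  have hsγ : √γ ^ 2 = γ := Real.sq_sqrt (by linarith)
  rcases hp.degree_eq with h | h <;> rw [h]
  · rw [Nat.cast_one, ← Real.sqrt_eq_rpow, pow_one]
    apply Real.lt_sqrt_of_sq_lt
    calc (6 * P.k * ((16 + c) * √γ)) ^ 2 = 36 * (16 + c) ^ 2 * (P.k ^ 2 * √γ ^ 2) := by
          ring
      _ = 36 * (16 + c) ^ 2 * (P.k ^ 2 * γ) := by rw [hsγ]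
      _ ≤ P.C * (P.k ^ 2 * γ) := by gcongr
      _ < _ := by
        have : P.C * (1 + (P.k : ℝ) ^ 2 * γ / 1) = P.C + P.C * (P.k ^ 2 * γ) := by ring
        linarith
  · rw [Nat.cast_ofNat, div_self two_ne_zero, Real.rpow_one]
    have hkk : (P.k : ℝ) ≤ P.k ^ 2 := by nlinarith
    calc 6 * P.k * ((16 + c) * √γ) ^ 2 = 6 * (16 + c) ^ 2 * (P.k * γ) := by
          rw [mul_pow, hsγ]; ring
      _ ≤ 36 * (16 + c) ^ 2 / 2 * (P.k ^ 2 * γ) := by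
        gcongr
        nlinarith [sq_nonneg (16 + c)]
      _ ≤ P.C / 2 * (P.k ^ 2 * γ) := by gcongr
      _ < _ := by
        have : P.C * (1 + (P.k : ℝ) ^ 2 * γ / 2) = P.C + P.C / 2 * (P.k ^ 2 * γ) := by ring
        linarith

/-- A heavy interval of a good multiset has a point within `16` of the mean of `p(G)`. -/
lemma IsHeavy.exists_near_integral {a : ℝ} (hα0 : 0 < P.α)
    (hdk : Real.exp 2 ≤ (d : ℝ) * (P.k : ℝ) * Real.log (1 / P.τ))
    (hp : IsSparsePoly P.k P.l p) (hvar : variance p (gaussianLaw μ) ≤ 1) (hT : T ≠ 0)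
    (hgood : IsGood P.k P.τ ρ μ P.α T) (ha : IsHeavy P T p a) :
    ∃ x ∈ T, |p x - ∫ y, p y ∂gaussianLaw μ| < 16 ∧ p x ∈ Set.Icc a (a + P.L) := by
  obtain ⟨-, hα1, ⟨S, hS, hST⟩, -⟩ := hgood
  have h3 := hS.prob_abs_ge_sixteen_le hp hvar hdk hα0 hα1
  obtain ⟨x, hx, h1, h2⟩ := exists_mem_inter (Q := fun x => ¬ 16 ≤ |p x - ∫ y, p y ∂gaussianLaw μ|)
      hα0 hα1 hT hST (by simpa only [not_not] using h3) ha
  exact ⟨x, hx, not_le.1 h1, h2⟩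

/-- The interval has mass above `1/2`; squared deviations above `2 Var` throughout it would already
exceed the variance, unless the variance is zero. -/
lemma IsHeavy.exists_near_mean {a : ℝ} (hα1 : P.α < 1) (hT : T ≠ 0) (ha : IsHeavy P T p a) :
    ∃ x ∈ T, (p x - mean T p) ^ 2 ≤ 2 * var T p ∧ p x ∈ Set.Icc a (a + P.L) := by
  classical
  by_contra! hn
  have hv0 : 0 ≤ var T p := by
    have := mean_le_mean (T := T) (f := fun _ => 0) (g := fun x => (p x - mean T p) ^ 2)
      fun x _ => sq_nonneg _
    rwa [mean_const hT] at this
  have hcount : 1 / 2 < prob T fun x => p x ∈ Set.Icc a (a + P.L) := by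
    unfold IsHeavy at ha
    linarith
  have hTc := card_pos_of_ne_zero hT
  have h1 : ∀ x ∈ T, (fun x => if p x ∈ Set.Icc a (a + P.L) then 2 * var T p else 0) x ≤
      (p x - mean T p) ^ 2 := by
    intro x hx
    dsimp only
    split_ifs with h
    · exact le_of_not_ge fun hle => hn x hx hle h
    · positivity
  have h2 := mean_sum_indicator (T := T) {()} (fun _ => 2 * var T p)
    (fun _ x => p x ∈ Set.Icc a (a + P.L))
  simp only [Finset.sum_singleton, mul_ite, mul_one, mul_zero] at h2
  have h3 := mean_le_mean h1
  have h4 : 2 * var T p * (prob T fun x => p x ∈ Set.Icc a (a + P.L)) ≤ var T p := by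
    rw [← h2]
    refine le_trans (le_of_eq ?_) h3
    congr!
  -- In the degenerate case all values of `p` on `T` equal the mean.
  have hv : var T p = 0 := by nlinarith
  obtain ⟨x, hx, hxI⟩ := ha.exists_mem hα1
  have hlt : ∀ y ∈ T, 0 ≤ (p y - mean T p) ^ 2 := fun y _ => sq_nonneg _
  have hsum : (T.map fun x => (p x - mean T p) ^ 2).sum = 0 := by
    have : (T.map fun x => (p x - mean T p) ^ 2).sum / T.card = 0 := hv
    exact (div_eq_zero_iff.1 this).resolve_right hTc.ne'
  have h5 : (p x - mean T p) ^ 2 ≤ (T.map fun x => (p x - mean T p) ^ 2).sum :=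
    Multiset.single_le_sum (by
      intro y hy
      obtain ⟨z, -, rfl⟩ := Multiset.mem_map.1 hy
      positivity) _ (Multiset.mem_map_of_mem _ hx)
  exact hn x hx (by rw [hv, mul_zero, ← hsum]; exact h5) hxI

lemma log_one_div_pos {α : ℝ} (hα0 : 0 < α) (hα1 : α < 1) : 0 < Real.log (1 / α) :=
  Real.log_pos (by rw [lt_div_iff₀ hα0]; linarith)

lemma sixteen_le_R {lam : ℝ} (hα0 : 0 < P.α) (hα1 : P.α < 1) (hl : P.l = 1 ∨ P.l = 2)
    (hlam : 0 < lam) (hle : lam ≤ Real.log (1 / P.α)) (hC : 16 + 256 / lam ≤ P.C) :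
    256 ≤ P.C * Real.log (1 / P.α) ∧ 16 ≤ P.R := by
  have h0 : 256 ≤ P.C * Real.log (1 / P.α) := by
    have h1 : 256 / lam ≤ P.C := by linarith
    have h2 : 0 < 256 / lam := by positivity
    have h3 : 0 ≤ P.C := by linarith
    calc (256 : ℝ) = 256 / lam * lam := by field_simp
      _ ≤ _ := by gcongr
  refine ⟨h0, ?_⟩
  unfold Params.R
  rcases hl with h | h <;> rw [h]
  · rw [Nat.cast_one, ← Real.sqrt_eq_rpow]
    apply Real.le_sqrt_of_sq_le
    linarith
  · norm_num
    norm_num at h0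
    linarith

lemma R_rpow (hα0 : 0 < P.α) (hα1 : P.α < 1) (hl : P.l = 1 ∨ P.l = 2) (hC : 0 ≤ P.C) :
    P.R ^ (2 / (P.l : ℝ)) = P.C * Real.log (1 / P.α) :=
  rpow_two_div_rpow_div_two hl (mul_nonneg hC (log_one_div_pos hα0 hα1).le)

lemma abs_integral_sub_mean_le {a lam C' : ℝ} (hα0 : 0 < P.α) (hα1 : P.α < 1) (hlam : 0 < lam)
    (hle : lam ≤ Real.log (1 / P.α)) (hC : 16 + 256 / lam ≤ P.C) (hC' : 0 < C')
    (hdk : Real.exp 2 ≤ (d : ℝ) * (P.k : ℝ) * Real.log (1 / P.τ))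
    (hp : IsSparsePoly P.k P.l p) (hvar : variance p (gaussianLaw μ) ≤ 1) (hT : T ≠ 0)
    (hgood : IsGood P.k P.τ ρ μ P.α T) (ha : IsHeavy P T p a)
    (hV : var T p ≤ C' * Real.log (1 / P.α) ^ P.l * Real.log (2 + Real.log (1 / P.α)) ^ 2) :
    |(∫ x, p x ∂gaussianLaw μ) - mean T p| ≤ (2 * P.C ^ 2 + 2 * C' + 1) *
      (Real.log (1 / P.α) ^ ((P.l : ℝ) / 2) * Real.log (2 + Real.log (1 / P.α))) := by
  have hl := hp.degree_eq
  have hg := log_two_le_log_two_add hα0 hα1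
  obtain ⟨h256, hR16⟩ := sixteen_le_R hα0 hα1 hl hlam hle hC
  obtain ⟨x, hx, hx1, hxI⟩ := ha.exists_near_integral hα0 hdk hp hvar hT hgood
  obtain ⟨y, hy, hy1, hyI⟩ := ha.exists_near_mean hα1 hT
  have hC16 : 16 ≤ P.C := by
    have : 0 < 256 / lam := by positivity
    linarith
  have hell := log_one_div_pos hα0 hα1
  set ell := Real.log (1 / P.α) with hell'
  set g := Real.log (2 + ell) with hg'
  have hE0 : 0 ≤ ell ^ ((P.l : ℝ) / 2) := by positivity
  have hg0 : 0 < g := by linarith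
  have hRC : P.R ≤ P.C * ell ^ ((P.l : ℝ) / 2) := by
    unfold Params.R
    rw [Real.mul_rpow (by linarith) hell.le]
    gcongr
    conv_rhs => rw [← Real.rpow_one P.C]
    apply Real.rpow_le_rpow_of_exponent_le (by linarith)
    rcases hl with h | h <;> rw [h] <;> norm_num
  have hL : P.L ≤ P.C ^ 2 * (ell ^ ((P.l : ℝ) / 2) * g) := by
    calc P.L = P.C * P.R * g := rfl
      _ ≤ P.C * (P.C * ell ^ ((P.l : ℝ) / 2)) * g := by gcongr
      _ = _ := by ring
  have h16 : 16 ≤ P.L := by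
    calc (16 : ℝ) ≤ P.R := hR16
      _ ≤ (P.C * g) * P.R := le_mul_of_one_le_left (by linarith) (by nlinarith)
      _ = P.L := by unfold Params.L; ring
  have hy2 : |p y - mean T p| ≤ (2 * C' + 1) * (ell ^ ((P.l : ℝ) / 2) * g) := by
    apply abs_le_of_sq_le_sq _ (by positivity)
    rw [mul_pow, mul_pow, rpow_div_two_sq hell.le]
    have : 2 * C' ≤ (2 * C' + 1) ^ 2 := by nlinarith
    calc _ ≤ 2 * C' * (ell ^ P.l * g ^ 2) := by linarith
      _ ≤ _ := by gcongr
  have hxy : |p x - p y| ≤ P.L := by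
    rw [abs_le]
    constructor <;> linarith [hxI.1, hxI.2, hyI.1, hyI.2]
  rw [abs_sub_comm] at hx1
  have t1 := abs_sub_le (∫ x, p x ∂gaussianLaw μ) (p x) (mean T p)
  have t2 := abs_sub_le (p x) (p y) (mean T p)
  nlinarith

/-- Here `R^{2/l} = C log(1/α)`. The part `16` of `C` gives the power of `α`, and the part `256 /
lam` gives the small numerical factor. -/
lemma tailBound_R_le {lam : ℝ} (hα0 : 0 < P.α) (hα1 : P.α < 1) (hl : P.l = 1 ∨ P.l = 2)
    (hlam : 0 < lam) (hle : lam ≤ Real.log (1 / P.α)) (hC : 16 + 256 / lam ≤ P.C)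
    (hdk : Real.exp 2 ≤ (d : ℝ) * (P.k : ℝ) * Real.log (1 / P.τ)) :
    tailBound d P.k P.l P.τ P.α P.R ≤ P.α ^ 2 / 120 := by
  have h0 : 0 < 256 / lam := by positivity
  unfold tailBound
  rw [R_rpow hα0 hα1 hl (by linarith)]
  have h1 := accuracy_le hdk hα0 hα1.le
  have h2 : P.α ^ 3 ≤ P.α ^ 2 := pow_le_pow_of_le_one hα0.le hα1.le (by norm_num)
  have h3 : Real.exp (-(P.C * Real.log (1 / P.α) / 4)) ≤ P.α ^ 2 * (1 / 1000) := by
    have e : 1 / 1000 = Real.exp (-Real.log 1000) := by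
      rw [Real.exp_neg, Real.exp_log (by norm_num), one_div]
    have e2 : P.α ^ 2 = Real.exp (-(2 * Real.log (1 / P.α))) := by
      rw [one_div, Real.log_inv, mul_neg, neg_neg, two_mul, Real.exp_add, Real.exp_log hα0, sq]
    rw [e2, e, ← Real.exp_add]
    apply Real.exp_le_exp.2
    have h5 : Real.log 1000 ≤ 7 := by
      calc Real.log 1000 ≤ Real.log (2 ^ 10) := Real.log_le_log (by norm_num) (by norm_num)
        _ = 10 * Real.log 2 := by rw [Real.log_pow]; norm_num
        _ ≤ 7 := by linarith [Real.log_two_lt_d9]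
    have h6 : (16 + 256 / lam) * Real.log (1 / P.α) ≤ P.C * Real.log (1 / P.α) :=
      mul_le_mul_of_nonneg_right hC (log_one_div_pos hα0 hα1).le
    have h7 : 256 ≤ 256 / lam * Real.log (1 / P.α) := by
      rw [div_mul_eq_mul_div, le_div_iff₀ hlam]
      linarith
    have := log_one_div_pos hα0 hα1
    linarith
  linarith [sq_nonneg P.α]

open scoped Classical in
-- The loss `α²/120` of `S`, times the factor `6/5` of `isGood_filter`, is exactly the discount
-- `α²/100` in `splitAlpha`. Removing a quarter-`α` fraction of `T` raises the level by at least
-- `α²/8`.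
lemma isGood_split {S : Multiset (Fin d → ℝ)} {Q : (Fin d → ℝ) → Prop} (hα0 : 0 < P.α)
    (hα1 : P.α < 1) (hdk : Real.exp 2 ≤ (d : ℝ) * (P.k : ℝ) * Real.log (1 / P.τ))
    (hS : IsRepresentative P.k P.τ μ P.α S)
    (hST : max ((1 - P.α / 6) * (S.card : ℝ)) (P.α * (T.card : ℝ)) ≤ ((S ∩ T).card : ℝ))
    (hdiam : ∀ x ∈ T, ∀ y ∈ T, ‖x - y‖ ≤ ρ) (hQ : (prob S fun x => ¬Q x) ≤ P.α ^ 2 / 120)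
    (hpos : (0 : ℝ) < (T.filter Q).card)
    (hcard : ((T.filter Q).card : ℝ) ≤ (1 - P.α / 4) * T.card) :
    IsGood P.k P.τ ρ μ (splitAlpha P T (T.filter Q)) (T.filter Q) := by
  have hα2 : P.α ^ 2 ≤ P.α := by nlinarith
  have hle : P.α * (1 + P.α / 8) ≤ splitAlpha P T (T.filter Q) := by
    unfold splitAlpha
    rw [le_div_iff₀ hpos]
    calc _ ≤ P.α * (1 + P.α / 8) * ((1 - P.α / 4) * T.card) := by gcongr
      _ = P.α * ((1 + P.α / 8) * (1 - P.α / 4)) * T.card := by ring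
      _ ≤ _ := by
        gcongr
        nlinarith
  refine isGood_filter hdk hα0 hα1.le hS hST hdiam ?_ hQ ?_ ?_ ?_
  · rintro h
    simp [h] at hpos
  · nlinarith
  · unfold splitAlpha
    rw [div_mul_cancel₀ _ hpos.ne']
    apply le_of_eq
    ring
  · nlinarith

lemma splitAlpha_pos {T' : Multiset (Fin d → ℝ)} (hα0 : 0 < P.α) (hα1 : P.α < 1) (hT : T ≠ 0)
    (hT' : (0 : ℝ) < T'.card) : 0 < splitAlpha P T T' := by
  have := card_pos_of_ne_zero hT
  have : 0 < 1 - P.α ^ 2 / 100 := by nlinarith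
  unfold splitAlpha
  positivity

lemma multifilterCondition_split {lam t : ℝ} (hα0 : 0 < P.α) (hα1 : P.α < 1) (hlam : 0 < lam)
    (hle : lam ≤ Real.log (1 / P.α)) (hC : 16 + 256 / lam ≤ P.C)
    (hdk : Real.exp 2 ≤ (d : ℝ) * (P.k : ℝ) * Real.log (1 / P.τ))
    (hp : IsSparsePoly P.k P.l p)
    (hvar : IsGood P.k P.τ ρ μ P.α T → variance p (gaussianLaw μ) ≤ 1) (hT : T ≠ 0)
    (ht : IsSplitThreshold P T p t) :
    MultifilterCondition P.k P.τ ρ μ P.α T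
      [(upper P T p t, splitAlpha P T (upper P T p t)),
        (lower P T p t, splitAlpha P T (lower P T p t))] := by
  classical
  have hl := hp.degree_eq
  have hTc := card_pos_of_ne_zero hT
  have hR : 0 < P.R := by linarith [(sixteen_le_R hα0 hα1 hl hlam hle hC).2]
  obtain ⟨ht1, ht2⟩ := ht
  have hcov : (T.card : ℝ) ≤ (upper P T p t).card + (lower P T p t).card := by
    have h1 : T.card = (T.filter fun x => t - P.R < p x).card +
        (T.filter fun x => ¬ t - P.R < p x).card := by
      rw [← Multiset.card_add, Multiset.filter_add_not]
    have h2 : (T.filter fun x => ¬ t - P.R < p x) ≤ lower P T p t :=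
      Multiset.monotone_filter_right _ fun x hx => by linarith [not_lt.1 hx]
    have h3 := Multiset.card_le_card h2
    have h4 : upper P T p t = T.filter fun x => t - P.R < p x := by
      unfold upper; congr!
    rw [h4]
    exact_mod_cast h1.le.trans (Nat.add_le_add_left h3 _)
  have hm1 := le_max_left ((upper P T p t).card : ℝ) ((lower P T p t).card : ℝ)
  have hm2 := le_max_right ((upper P T p t).card : ℝ) ((lower P T p t).card : ℝ)
  have hαT : 0 < P.α * T.card := by positivity
  have hu : (0 : ℝ) < (upper P T p t).card := by linarith
  have hw : (0 : ℝ) < (lower P T p t).card := by linarith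
  refine ⟨?_, ?_, fun hgood => ?_⟩
  · intro q hq
    simp only [List.mem_cons, List.not_mem_nil, or_false] at hq
    rcases hq with rfl | rfl
    · exact ⟨Multiset.filter_le _ _, splitAlpha_pos hα0 hα1 hT hu⟩
    · exact ⟨Multiset.filter_le _ _, splitAlpha_pos hα0 hα1 hT hw⟩
  · simp only [List.map_cons, List.map_nil, List.sum_cons, List.sum_nil, add_zero, splitAlpha]
    have h1 : 0 < 1 - P.α ^ 2 / 100 := by nlinarith
    have e : ∀ x y : ℝ, 1 / (P.α * (1 - P.α ^ 2 / 100) * T.card / x) ^ 2 +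
        1 / (P.α * (1 - P.α ^ 2 / 100) * T.card / y) ^ 2 =
        (x ^ 2 + y ^ 2) / (P.α * (1 - P.α ^ 2 / 100) * T.card) ^ 2 := fun x y => by
      rw [div_pow, div_pow, one_div_div, one_div_div, add_div]
    rw [e, div_le_div_iff₀ (by positivity) (by positivity), one_mul]
    -- The discount in the levels is paid for by the slack `1 - α/100 ≤ 1 - α²/100` of the split
    -- threshold.
    calc _ ≤ (T.card : ℝ) ^ 2 * (1 - P.α / 100) ^ 2 * P.α ^ 2 := by gcongr
      _ ≤ (T.card : ℝ) ^ 2 * (1 - P.α ^ 2 / 100) ^ 2 * P.α ^ 2 := by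
        gcongr
        · linarith
        · nlinarith
      _ = _ := by ring
  · have hv := hvar hgood
    obtain ⟨-, -, ⟨S, hS, hST⟩, hdiam⟩ := hgood
    have htail := tailBound_R_le hα0 hα1 hl hlam hle hC hdk
    -- The part on the side of `E[p(G)]` loses only values at distance at least `R` from it.
    rcases le_total t (∫ y, p y ∂gaussianLaw μ) with h | h
    · refine ⟨_, List.mem_cons_self, ?_⟩
      refine isGood_split hα0 hα1 hdk hS hST hdiam ?_ hu (by unfold upper at *; linarith)
      refine (le_trans (prob_mono fun x _ hx => ?_) (hS.prob_le_le hp hv hR.le)).trans htail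
      linarith [not_lt.1 hx]
    · refine ⟨_, List.mem_cons_of_mem _ List.mem_cons_self, ?_⟩
      refine isGood_split hα0 hα1 hdk hS hST hdiam ?_ hw (by unfold lower at *; linarith)
      refine (le_trans (prob_mono fun x _ hx => ?_) (hS.prob_ge_le hp hv hR.le)).trans htail
      linarith [not_lt.1 hx]

lemma multifilterCondition_filter {lam a t : ℝ} (hα0 : 0 < P.α) (hα1 : P.α < 1) (hlam : 0 < lam)
    (hle : lam ≤ Real.log (1 / P.α)) (hC : 16 + 256 / lam ≤ P.C)
    (hdk : Real.exp 2 ≤ (d : ℝ) * (P.k : ℝ) * Real.log (1 / P.τ))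
    (hp : IsSparsePoly P.k P.l p)
    (hvar : IsGood P.k P.τ ρ μ P.α T → variance p (gaussianLaw μ) ≤ 1) (hT : T ≠ 0)
    (ha : IsHeavy P T p a) (ht : IsFilterThreshold P T p a t) :
    MultifilterCondition P.k P.τ ρ μ P.α T
      [(filtered P T p a t, filteredAlpha P T (filtered P T p a t))] := by
  classical
  have hl := hp.degree_eq
  have hTc := card_pos_of_ne_zero hT
  obtain ⟨h256, hR16⟩ := sixteen_le_R hα0 hα1 hl hlam hle hC
  obtain ⟨ht1, ht2⟩ := ht
  set η := prob T fun x => t ≤ distInterval a (a + P.L) (p x) with hη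
  have hη0 : 0 ≤ η := prob_nonneg
  have hcard : ((filtered P T p a t).card : ℝ) = (1 - η) * T.card := by
    rw [filtered, card_filter_eq hT,
      ← prob_add_prob_not (P := fun x => t ≤ distInterval a (a + P.L) (p x)) hT]
    simp [hη]
  have hpos : (0 : ℝ) < (filtered P T p a t).card := by
    obtain ⟨x, hx, hxI⟩ := ha.exists_mem hα1
    have h1 := distInterval_le_abs_sub (y := p x) hxI
    rw [sub_self, abs_zero] at h1
    have : x ∈ filtered P T p a t := by
      unfold filtered
      exact Multiset.mem_filter.2 ⟨hx, by linarith⟩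
    exact_mod_cast Multiset.card_pos_iff_exists_mem.2 ⟨x, this⟩
  have hη1 : 0 < 1 - η := by
    rw [hcard] at hpos
    exact pos_of_mul_pos_left hpos hTc.le
  have hα' : filteredAlpha P T (filtered P T p a t) =
      P.α * ((1 - P.α / 8) / (1 - η) + P.α / 8) := by
    rw [filteredAlpha, hcard, mul_div_mul_right _ _ hTc.ne']
  have hα'le : P.α * (1 + 7 / 8 * η) ≤ filteredAlpha P T (filtered P T p a t) := by
    rw [hα']
    refine mul_le_mul_of_nonneg_left ?_ hα0.le
    rw [← sub_le_iff_le_add, le_div_iff₀ hη1]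
    nlinarith [mul_nonneg hη0 hη0, mul_nonneg (sub_nonneg.2 hα1.le) hη0]
  have hαα' : P.α ≤ filteredAlpha P T (filtered P T p a t) := by nlinarith
  refine ⟨?_, ?_, fun hgood => ⟨_, List.mem_cons_self, ?_⟩⟩
  · intro q hq
    simp only [List.mem_cons, List.not_mem_nil, or_false] at hq
    subst hq
    exact ⟨Multiset.filter_le _ _, hα0.trans_le hαα'⟩
  · simp only [List.map_cons, List.map_nil, List.sum_cons, List.sum_nil, add_zero]
    gcongr
  · have hv := hvar hgood
    obtain ⟨x₀, -, hx₀, hx₀I⟩ := ha.exists_near_integral hα0 hdk hp hv hT hgood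
    obtain ⟨-, -, ⟨S, hS, hST⟩, hdiam⟩ := hgood
    -- The interval contains a value within `16 ≤ R` of `E[p(G)]`, so distance `t` from the interval
    -- means distance at least `t - R` from that mean.
    have hS1 : (prob S fun x => ¬ distInterval a (a + P.L) (p x) < t) ≤
        2 * tailBound d P.k P.l P.τ P.α (t - P.R) := by
      refine le_trans (prob_mono fun x _ hx => ?_)
        (hS.prob_abs_ge_le hp hv (s := t - P.R) (by linarith))
      have h1 := distInterval_le_abs_sub (y := p x) hx₀I
      rw [abs_sub_comm] at hx₀
      have h2 := abs_sub_le (p x) (∫ y, p y ∂gaussianLaw μ) (p x₀)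
      have h3 := not_lt.1 hx
      linarith
    have htail : 2 * tailBound d P.k P.l P.τ P.α (t - P.R) ≤ P.α * η / 32 := by
      set e := (2 : ℝ) / P.l with he
      have he0 : 0 ≤ e := by positivity
      have hC16 : 16 ≤ P.C := by
        have : 0 < 256 / lam := by positivity
        linarith
      have h1 : (t - 2 * P.R) ^ e ≤ (t - P.R) ^ e :=
        Real.rpow_le_rpow (by linarith) (by linarith) he0
      have h2 : 256 ≤ (t - P.R) ^ e := by
        refine h256.trans ?_
        rw [← R_rpow hα0 hα1 hl (by linarith)]
        exact Real.rpow_le_rpow (by linarith) (by linarith) he0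
      -- Half of the exponent, at least `256 / 8`, supplies the factor `1 / 4`; the other half beats
      -- `1 / C`.
      have h3 : Real.exp (-((t - P.R) ^ e / 4)) ≤
          1 / 4 * Real.exp (-((t - 2 * P.R) ^ e / P.C)) := by
        have h4 : Real.exp (-3) ≤ 1 / 4 := by
          rw [Real.exp_neg, one_div]
          gcongr
          linarith [Real.add_one_le_exp 3]
        have h5 : (t - 2 * P.R) ^ e / P.C ≤ (t - 2 * P.R) ^ e / 8 := by
          have : 0 ≤ (t - 2 * P.R) ^ e := Real.rpow_nonneg (by linarith) _
          gcongr
          linarith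
        calc _ ≤ Real.exp (-3 + -((t - 2 * P.R) ^ e / P.C)) := by
              apply Real.exp_le_exp.2
              linarith
          _ = Real.exp (-3) * Real.exp (-((t - 2 * P.R) ^ e / P.C)) := Real.exp_add _ _
          _ ≤ _ := by gcongr
      have h6 : accuracy d P.k P.τ P.α ≤
          P.α / 200 * (2 * P.α ^ 2 / ((P.k : ℝ) ^ 2 * logFactor d P.k P.α P.τ) ^ 2) := by
        unfold accuracy
        apply le_of_eq
        rw [mul_pow, ← pow_mul]
        ring
      have h7 : 0 ≤ 2 * P.α ^ 2 / ((P.k : ℝ) ^ 2 * logFactor d P.k P.α P.τ) ^ 2 := by positivity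
      have h8 := mul_le_mul_of_nonneg_left ht2.le (show 0 ≤ P.α / 32 by positivity)
      have h9 : P.α / 32 * (32 / P.α * Real.exp (-((t - 2 * P.R) ^ e / P.C))) =
          Real.exp (-((t - 2 * P.R) ^ e / P.C)) := by
        field_simp
      rw [mul_add, h9] at h8
      have h10 := mul_nonneg hα0.le h7
      unfold tailBound
      linarith
    refine isGood_filter hdk hα0 hα1.le hS hST hdiam ?_ (hS1.trans htail) hαα' ?_ ?_
    · intro h
      have hpos' : (0 : ℝ) < (T.filter fun x => distInterval a (a + P.L) (p x) < t).card := hpos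
      simp [h] at hpos'
    · change filteredAlpha P T (filtered P T p a t) * ((filtered P T p a t).card : ℝ) ≤ _
      rw [hα', hcard]
      have : P.α * ((1 - P.α / 8) / (1 - η) + P.α / 8) * ((1 - η) * T.card) =
          P.α * T.card * (1 - P.α * η / 8) := by
        field_simp
        ring
      rw [this]
      gcongr
      nlinarith [mul_nonneg hα0.le hη0]
    · nlinarith [mul_nonneg hα0.le hη0]

/-! ### Runs of the algorithm -/

/-- The invariant records the tests passed on the way, such as heaviness of the chosen interval,
which the later transitions do not repeat. -/
lemma Reachable.cases {s : State d} (h : Reachable P T p s) :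
    s = .start ∨ (∃ a, s = .interval a ∧ ¬ DiameterTest P T p ∧ IsHeavy P T p a) ∨
    (s = .noInterval ∧ ¬ ∃ a, IsHeavy P T p a) ∨ (s = .done .no ∧ DiameterTest P T p) ∨
    (∃ a, s = .done .yes ∧ IsHeavy P T p a ∧ VarianceTest P T p) ∨
    (∃ a t, s = .done (.list [(filtered P T p a t, filteredAlpha P T (filtered P T p a t))]) ∧
      IsHeavy P T p a ∧ IsFilterThreshold P T p a t) ∨
    (∃ t, s = .done (.list [(upper P T p t, splitAlpha P T (upper P T p t)),
      (lower P T p t, splitAlpha P T (lower P T p t))]) ∧ IsSplitThreshold P T p t) := by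
  induction h with
  | refl => exact Or.inl rfl
  | tail _ hstep ih =>
    cases hstep with
    | reject hD => simp [hD]
    | oneCluster a hD ha => simp [hD, ha]
    | spread hD hn => simp [hn]
    | accept a hV =>
      simp only [reduceCtorEq, State.interval.injEq, false_and, exists_false, false_or, or_false]
        at ih
      obtain ⟨a', rfl, -, ha⟩ := ih
      exact .inr (.inr (.inr (.inr (.inl ⟨_, rfl, ha, hV⟩))))
    | filter a t hV ht =>
      simp only [reduceCtorEq, State.interval.injEq, false_and, exists_false, false_or, or_false]
        at ih
      obtain ⟨a', rfl, -, ha⟩ := ih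
      exact .inr (.inr (.inr (.inr (.inr (.inl ⟨_, t, rfl, ha, ht⟩)))))
    | split t ht => exact .inr (.inr (.inr (.inr (.inr (.inr ⟨t, rfl, ht⟩)))))

end correct

end SparseMultifilter

end

/-! ### Choice of the constants and the proposition -/

theorem mainTheorem3 (c αmax : ℝ) (hc : 0 < c) (hαmax : αmax < 1) :
    ∃ C₀ : ℝ, 0 < C₀ ∧ ∀ C : ℝ, C₀ ≤ C →
    ∃ C₁ : ℝ, 0 < C₁ ∧ ∀ C' : ℝ, C₁ ≤ C' →
    ∃ K : ℝ, 0 < K ∧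
    ∀ (d k l : ℕ) (α τ ρ : ℝ) (μ : Fin d → ℝ) (T : Multiset (Fin d → ℝ)) (p : (Fin d → ℝ) → ℝ),
      0 < α → α ≤ αmax → 0 < τ → τ < 1 →
      Real.exp 2 ≤ (d : ℝ) * (k : ℝ) * Real.log (1 / τ) →
      ρ ≤ c * Real.sqrt (SparseMultifilter.logFactor d k α τ) →
      T ≠ 0 →
      SparseMultifilter.IsSparsePoly k l p →
      (SparseMultifilter.IsGood k τ ρ μ α T →
        ProbabilityTheory.variance p (SparseMultifilter.gaussianLaw μ) ≤ 1) →
      (∀ s, SparseMultifilter.Reachable ⟨k, l, α, τ, C, C'⟩ T p s →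
        (∃ out, s = .done out) ∨ ∃ s', SparseMultifilter.Step ⟨k, l, α, τ, C, C'⟩ T p s s') ∧
      (∀ out, SparseMultifilter.Reachable ⟨k, l, α, τ, C, C'⟩ T p (.done out) →
        SparseMultifilter.Guarantee K ρ μ ⟨k, l, α, τ, C, C'⟩ T p out) := by
  open SparseMultifilter in
  rcases le_or_gt αmax 0 with hneg | hαpos
  · exact ⟨1, one_pos, fun C _ => ⟨1, one_pos, fun C' _ => ⟨1, one_pos,
      fun d k l α τ ρ μ T p h1 h2 => absurd (h1.trans_le h2) (not_lt.2 hneg)⟩⟩⟩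
  set lam := Real.log (1 / αmax) with hlam'
  have hlam : 0 < lam := log_one_div_pos hαpos hαmax
  -- `16 + 256 / lam` makes `R ≥ 16` and the tail beyond `R` small; `36 (16 + c)²` serves the
  -- diameter test.
  refine ⟨16 + 256 / lam + 36 * (16 + c) ^ 2, by positivity, fun C hC => ?_⟩
  have h256 : 0 < 256 / lam := by positivity
  have hc36 : 0 < 36 * (16 + c) ^ 2 := by positivity
  have hC0 : 0 < C := by linarith
  -- The constant of `variance_bound`: a failed variance test then exceeds what integrating
  -- inadmissible tails would allow.
  refine ⟨C ^ 4 + 48 * C ^ 2 + 120 * (C * (1 + 4 / lam)) ^ 2, by positivity, fun C' hC' => ?_⟩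
  have hC'0 : 0 < C' := lt_of_lt_of_le (by positivity) hC'
  refine ⟨2 * C ^ 2 + 2 * C' + 1, by positivity, ?_⟩
  intro d k l α τ ρ μ T p hα0 hαle _ _ hdk hρ hT hp hvar
  have hα1 : α < 1 := hαle.trans_lt hαmax
  have hle : lam ≤ Real.log (1 / α) := by
    rw [hlam']
    gcongr
  have hl := hp.degree_eq
  have hell := log_one_div_pos hα0 hα1
  set P : Params := ⟨k, l, α, τ, C, C'⟩ with hP
  constructor
  · intro s hs
    rcases hs.cases with rfl | ⟨a, rfl, hD, ha⟩ | ⟨rfl, hn⟩ | ⟨rfl, -⟩ | ⟨a, rfl, -⟩ |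
      ⟨a, t, rfl, -⟩ | ⟨t, rfl, -⟩
    · right
      by_cases hD : DiameterTest P T p
      · exact ⟨_, .reject hD⟩
      by_cases hH : ∃ a, IsHeavy P T p a
      · obtain ⟨a, ha⟩ := hH
        exact ⟨_, .oneCluster a hD ha⟩
      · exact ⟨_, .spread hD hH⟩
    · right
      by_cases hV : VarianceTest P T p
      · exact ⟨_, .accept a hV⟩
      · obtain ⟨t, ht⟩ := exists_isFilterThreshold (P := P) hl hα0 hα1
          (show 12 ≤ C by linarith) hdk hT hD ha (by
            refine (variance_bound (P := P) hl hα0 hα1 (show 12 ≤ C by linarith) hlam hle).trans_lt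
              (lt_of_le_of_lt ?_ (not_le.1 hV))
            gcongr)
        exact ⟨_, .filter a t hV ht⟩
    · right
      obtain ⟨t, ht⟩ := exists_isSplitThreshold (P := P) hα0 hα1 (show 12 ≤ C by linarith) hT hn
      exact ⟨_, .split t ht⟩
    · exact .inl ⟨_, rfl⟩
    · exact .inl ⟨_, rfl⟩
    · exact .inl ⟨_, rfl⟩
    · exact .inl ⟨_, rfl⟩
  · intro out hs
    have hC16 : 16 + 256 / lam ≤ P.C := show _ ≤ C by linarith
    rcases hs.cases with h | ⟨a, h, -⟩ | ⟨h, -⟩ | ⟨h, hD⟩ | ⟨a, h, ha, hV⟩ |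
      ⟨a, t, h, ha, ht⟩ | ⟨t, h, ht⟩
    · cases h
    · cases h
    · cases h
    · cases h
      exact fun hgood => not_diameterTest (P := P) hc hα0 (show _ ≤ C by linarith) hdk hρ hp
        (hvar hgood) hT hgood hD
    · cases h
      refine ⟨hV.trans ?_, fun hgood => abs_integral_sub_mean_le (P := P) hα0 hα1 hlam hle hC16
        hC'0 hdk hp (hvar hgood) hT hgood ha hV⟩
      rw [mul_assoc]
      gcongr
      change C' ≤ _
      nlinarith [sq_nonneg C]
    · cases h
      exact ⟨.inl rfl, multifilterCondition_filter (P := P) hα0 hα1 hlam hle hC16 hdk hp hvar hT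
        ha ht⟩
    · cases h
      exact ⟨.inr rfl, multifilterCondition_split (P := P) hα0 hα1 hlam hle hC16 hdk hp hvar hT ht⟩
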